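/- **Setting.** Let $\kappa$ be the reproducing kernel of a real RKHS $\mathcal H$ of functions on a measurable space $\mathcal X$, jointly measurable with $0\le\kappa\le K$. For a probability measure $P$ on $\mathcal X$ let $\mu_P=E_{x\sim P}[\kappa(\cdot,x)]\in\mathcal H$ be its kernel mean embedding, and put $$\mathrm{MMD}^2(P,Q)=\|\mu_P-\mu_Q\|^2,\quad \mathrm{NORM}(P,Q)=4K-\|\mu_P\|^2-\|\mu_Q\|^2,\quad \mathrm{NAMMD}(P,Q)=\frac{\mathrm{MMD}^2(P,Q)}{\mathrm{NORM}(P,Q)}.$$ For independent samples $X=(x_i)_{i\le m}\sim P^m$, $Y=(y_i)_{i\le m}\sim Q^m$, $m\ge 2$, let $H_{ij}=\kappa(x_i,x_j)+\kappa(y_i,y_j)-\kappa(x_i,y_j)-\kappa(y_i,x_j)$ and $$\widehat{\mathrm{MMD}}^2=\frac1{m(m-1)}\sum_{i\ne j}H_{ij},\qquad \widehat{\mathrm{NAMMD}}=\frac{\sum_{i\neq j}H_{ij}}{\sum_{i\ne j}\bigl(4K-\kappa(x_i,x_j)-\kappa(y_i,y_j)\bigr)} .$$ Let $(P_1,Q_1)$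 be the reference pair and $(P_2,Q_2)$ the pair from which the samples are drawn. Write $M_k,\,N_k,\,\epsilon_k$ for $\mathrm{MMD}^2,\mathrm{NORM},\mathrm{NAMMD}$ of $(P_k,Q_k)$. Let $\Phi$ be the standard normal distribution function, $z_{1-\alpha}$ its $(1-\alpha)$-quantile, and, with expectations under $(P_2,Q_2)$, $$\sigma_M^2=4E[H_{12}H_{13}]-4(E[H_{12}])^2,\qquad \sigma_*^2=4E[G_{12}G_{13}]-4(E[G_{12}])^2,$$ where $G_{ij}=H_{ij}-\epsilon_2\bigl(4K-\kappa(x_i,x_j)-\kappa(y_i,y_j)\bigr)$, and $\sigma_M,\sigma_*\ge 0$. The MMD-based test rejects when $\sqrt m\,\widehat{\mathrm{MMD}}^2>\tau^M_\alpha$ and the NAMMD-based test rejects when $\sqrt m\,\widehat{\mathrm{NAMMD}}>\tau_\alpha^N$, with the normal thresholds $$\tau_\alpha^M=\sqrt m\,M_1+\sigma_M z_{1-\alpha},\qquad \tau_\alpha^N=\sqrt m\,\epsilon_1+\frac{\sigma_M}{N_2}\,z_{1-\alpha}.$$ Finally let $$\Delta=\sqrt m\,\epsilon_1\,\frac{\|\mu_{P_2}\|^2+\|\mu_{Q_2}\|^2-\|\mu_{P_1}\|^2-\|\mu_{Q_1}\|^2}{\sqrt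 m\,M_1+\sigma_Mz_{1-\alpha}},\qquad C_2=\Bigl(\frac{(z_{1-\alpha}+0.7)\,\sigma_M}{M_2-M_1}\Bigr)^2,$$ $$C_1(s)=\max\left\{\Bigl(\frac{z_{1-\alpha}\sigma_M}{M_2-M_1}\Bigr)^2,\ \Bigl(\frac{0.051\,\sigma_M+0.751\,\max(0,s-\sigma_M)}{(1-N_2/N_1)\,M_1}\Bigr)^2\right\}\qquad(s\ge 0).$$ **Theorem.** For all $\kappa$, $K$, $P_2$, $Q_2$ there is $m_0\in\mathbb N$ (depending only on these) such that the following holds for every $\alpha\in(0,1)$, every reference pair $(P_1,Q_1)$ with $\epsilon_1>0$, $\epsilon_2>\epsilon_1$, $M_2>M_1$ and $$\|\mu_{P_1}\|^2+\|\mu_{Q_1}\|^2<\|\mu_{P_2}\|^2+\|\mu_{Q_2}\|^2,$$ and every $m\ge2$. 1. If $\alpha\le 1/2$, then $\Delta\in(0,1/2)$. Whenever $\Delta\in(0,1/2)$, with probability at least $$1-\exp\left(-\frac{m\,\Delta^2\,N_2^2}{4K^2(1-\Delta)^2}\right)$$ over $X\sim P_2^m$, $Y\sim Q_2^m$, the implication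 $\ \sqrt m\,\widehat{\mathrm{MMD}}^2>\tau^M_\alpha\Rightarrow\sqrt m\,\widehat{\mathrm{NAMMD}}>\tau^N_\alpha\ $ holds. 2. (Gap of the normal approximations of the powers.) If $C_1(\sigma_M)\le m\le C_2$, then $$\Phi\left(\frac{\sqrt m\,\epsilon_2-\tau^N_\alpha}{\sigma_M/N_2}\right)-\Phi\left(\frac{\sqrt m\,M_2-\tau_\alpha^M}{\sigma_M}\right)\ \ge\ \frac1{65}.$$ 3. If $\max\{m_0,\,C_1(\sigma_*)\}\le m\le C_2$, then with probability at least $1/65$ over $X\sim P_2^m$, $Y\sim Q_2^m$, $$\sqrt m\,\widehat{\mathrm{MMD}}^2\le\tau^M_\alpha\quad\text{and yet}\quad \sqrt m\,\widehat{\mathrm{NAMMD}}>\tau_\alpha^N .$$ -/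

import Mathlib

open MeasureTheory ProbabilityTheory Filter Topology

noncomputable section

namespace NAMMD

/-- The scalar reproducing kernel `κ(x, y)` of a real RKHS `H` of functions on `S`. -/
def ker {S : Type*} (H : Type*) [NormedAddCommGroup H] [InnerProductSpace ℝ H] [CompleteSpace H]
    [RKHS ℝ H S ℝ] (x y : S) : ℝ :=
  RKHS.kernel H x y 1

/-- `κ` is jointly measurable and `0 ≤ κ(x, y) ≤ K` for all `x, y`. -/
structure IsBoundedKernel {S : Type*} [MeasurableSpace S] (H : Type*) [NormedAddCommGroup H]
    [InnerProductSpace ℝ H] [CompleteSpace H] [RKHS ℝ H S ℝ] (K : ℝ) : Prop where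
  measurable : Measurable fun p : S × S => ker H p.1 p.2
  nonneg : ∀ x y : S, 0 ≤ ker H x y
  le : ∀ x y : S, ker H x y ≤ K

open Classical in
/-- The kernel mean embedding `μ_P = E_{x ∼ P} κ(·, x)`, the expectation being taken in the weak
sense: it is the element of `H` with `⟪μ_P, f⟫ = E_{x ∼ P} f(x)` for every `f` in `H`.
(For a bounded measurable kernel it exists, see `inner_meanEmbedding`.) -/
def meanEmbedding {S : Type*} [MeasurableSpace S] (H : Type*) [NormedAddCommGroup H]
    [InnerProductSpace ℝ H] [CompleteSpace H] [RKHS ℝ H S ℝ] (P : Measure S) : H :=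
  if h : ∃ μ : H, ∀ f : H, inner ℝ μ f = ∫ x, f x ∂P then h.choose else 0

section existence

variable {S : Type*} [MeasurableSpace S] {H : Type*} [NormedAddCommGroup H]
  [InnerProductSpace ℝ H] [CompleteSpace H] [RKHS ℝ H S ℝ] {K : ℝ}

theorem IsBoundedKernel.measurable_coe (hK : IsBoundedKernel H K) (f : H) :
    Measurable (f : S → ℝ) := by
  have hspan : ∀ g ∈ Submodule.span ℝ {RKHS.kerFun H x v | (x : S) (v : ℝ)},
      Measurable (g : S → ℝ) := by
    intro g hg
    induction hg using Submodule.span_induction with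
    | mem g hg =>
      obtain ⟨x, v, rfl⟩ := hg
      have h1 : (fun y => RKHS.kerFun H x v y) = fun y => v * ker H y x := by
        funext y
        rw [RKHS.kerFun_apply, ker]
        conv_lhs => rw [show v = v • (1 : ℝ) by simp, map_smul]
        simp
      change Measurable fun y => RKHS.kerFun H x v y
      rw [h1]
      exact (hK.measurable.comp (measurable_id.prodMk measurable_const)).const_mul v
    | zero => rw [RKHS.coe_zero]; exact measurable_zero
    | add g h _ _ hg hh => rw [RKHS.coe_add]; exact hg.add hh
    | smul c g _ hg => rw [RKHS.coe_smul]; exact hg.const_smul c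
  have hf : f ∈ closure (Submodule.span ℝ {RKHS.kerFun H x v | (x : S) (v : ℝ)} : Set H) := by
    have := RKHS.kerFun_dense (𝕜 := ℝ) (X := S) (V := ℝ) H
    rw [← Submodule.topologicalClosure_coe, this]
    trivial
  obtain ⟨u, hu, hlim⟩ := mem_closure_iff_seq_limit.mp hf
  refine measurable_of_tendsto_metrizable (f := fun n => (u n : S → ℝ))
    (fun n => hspan _ (hu n)) ?_
  rw [tendsto_pi_nhds]
  intro x
  exact ((RKHS.continuous_eval (𝕜 := ℝ) (H := H) x).tendsto f).comp hlim

theorem IsBoundedKernel.abs_apply_le (hK : IsBoundedKernel (S := S) H K) (f : H) (x : S) :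
    ‖f x‖ ≤ ‖f‖ * √K := by
  refine (RKHS.norm_apply_le (𝕜 := ℝ) f x).trans ?_
  refine mul_le_mul_of_nonneg_left (Real.sqrt_le_sqrt ?_) (norm_nonneg _)
  have h0 : 0 ≤ K := (hK.nonneg x x).trans (hK.le x x)
  refine ContinuousLinearMap.opNorm_le_bound _ h0 fun v => ?_
  have h1 : RKHS.kernel H x x v = v * ker H x x := by
    rw [ker]
    conv_lhs => rw [show v = v • (1 : ℝ) by simp, map_smul]
    simp
  rw [h1, norm_mul, mul_comm, Real.norm_of_nonneg (hK.nonneg x x)]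
  exact mul_le_mul_of_nonneg_right (hK.le x x) (norm_nonneg _)

theorem IsBoundedKernel.integrable_coe (hK : IsBoundedKernel H K) (P : Measure S)
    [IsProbabilityMeasure P] (f : H) : Integrable (f : S → ℝ) P :=
  Integrable.of_bound (hK.measurable_coe f).aestronglyMeasurable (‖f‖ * √K)
    (ae_of_all _ (hK.abs_apply_le f))

/-- The defining property of the kernel mean embedding. -/
theorem inner_meanEmbedding (hK : IsBoundedKernel H K) (P : Measure S)
    [IsProbabilityMeasure P] (f : H) : inner ℝ (meanEmbedding H P) f = ∫ x, f x ∂P := by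
  have hex : ∃ μ : H, ∀ f : H, inner ℝ μ f = ∫ x, f x ∂P := by
    let L : H →ₗ[ℝ] ℝ :=
      { toFun := fun f => ∫ x, f x ∂P
        map_add' := fun f g => by
          simp only [RKHS.coe_add, Pi.add_apply]
          exact integral_add (hK.integrable_coe P f) (hK.integrable_coe P g)
        map_smul' := fun c f => by
          simp only [RKHS.coe_smul, Pi.smul_apply, RingHom.id_apply]
          exact integral_smul c _ }
    have hL : ∀ f, ‖L f‖ ≤ √K * ‖f‖ := fun f => by
      have := norm_integral_le_of_norm_le_const (μ := P) (ae_of_all _ (hK.abs_apply_le f))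
      rw [mul_comm]
      rw [probReal_univ, mul_one] at this
      exact this
    refine ⟨(InnerProductSpace.toDual ℝ H).symm (L.mkContinuous _ hL), fun f => ?_⟩
    rw [InnerProductSpace.toDual_symm_apply]
    rfl
  rw [meanEmbedding, dif_pos hex]
  exact hex.choose_spec f

end existence

/-! ### Population quantities -/

/-- The squared maximum mean discrepancy `‖μ_P - μ_Q‖²`. -/
def mmdSq {S : Type*} [MeasurableSpace S] (H : Type*) [NormedAddCommGroup H]
    [InnerProductSpace ℝ H] [CompleteSpace H] [RKHS ℝ H S ℝ] (P Q : Measure S) : ℝ :=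
  ‖meanEmbedding H P - meanEmbedding H Q‖ ^ 2

/-- `NORM(P, Q) = 4K - ‖μ_P‖² - ‖μ_Q‖²`. -/
def normTerm {S : Type*} [MeasurableSpace S] (H : Type*) [NormedAddCommGroup H]
    [InnerProductSpace ℝ H] [CompleteSpace H] [RKHS ℝ H S ℝ] (K : ℝ) (P Q : Measure S) : ℝ :=
  4 * K - ‖meanEmbedding H P‖ ^ 2 - ‖meanEmbedding H Q‖ ^ 2

/-- The norm-adaptive maximum mean discrepancy. -/
def nammd {S : Type*} [MeasurableSpace S] (H : Type*) [NormedAddCommGroup H]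
    [InnerProductSpace ℝ H] [CompleteSpace H] [RKHS ℝ H S ℝ] (K : ℝ) (P Q : Measure S) : ℝ :=
  mmdSq H P Q / normTerm H K P Q

/-! ### Samples and estimators -/

/-- A pair of samples `X = (x_i)` and `Y = (y_j)` of common size `m`. -/
abbrev Samples (S : Type*) (m : ℕ) : Type _ := (Fin m → S) × (Fin m → S)

/-- The law of `(X, Y)` with `X ∼ P^m` and `Y ∼ Q^m` independent. -/
def samplesLaw {S : Type*} [MeasurableSpace S] (P Q : Measure S) (m : ℕ) :
    Measure (Samples S m) :=
  (Measure.pi fun _ => P).prod (Measure.pi fun _ => Q)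

/-- `H_{i,j} = κ(x_i, x_j) + κ(y_i, y_j) - κ(x_i, y_j) - κ(y_i, x_j)`. -/
def hTerm {S : Type*} (H : Type*) [NormedAddCommGroup H] [InnerProductSpace ℝ H]
    [CompleteSpace H] [RKHS ℝ H S ℝ] {m : ℕ} (Z : Samples S m) (i j : Fin m) : ℝ :=
  ker H (Z.1 i) (Z.1 j) + ker H (Z.2 i) (Z.2 j) - ker H (Z.1 i) (Z.2 j) - ker H (Z.2 i) (Z.1 j)

/-- `4K - κ(x_i, x_j) - κ(y_i, y_j)`. -/
def nTerm {S : Type*} (H : Type*) [NormedAddCommGroup H] [InnerProductSpace ℝ H]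
    [CompleteSpace H] [RKHS ℝ H S ℝ] (K : ℝ) {m : ℕ} (Z : Samples S m) (i j : Fin m) : ℝ :=
  4 * K - ker H (Z.1 i) (Z.1 j) - ker H (Z.2 i) (Z.2 j)

/-- The empirical estimator `(m(m-1))⁻¹ ∑_{i ≠ j} H_{i,j}` of the squared MMD. -/
def mmdSqHat {S : Type*} (H : Type*) [NormedAddCommGroup H] [InnerProductSpace ℝ H]
    [CompleteSpace H] [RKHS ℝ H S ℝ] {m : ℕ} (Z : Samples S m) : ℝ :=
  (∑ p ∈ (Finset.univ : Finset (Fin m)).offDiag, hTerm H Z p.1 p.2) / ((m : ℝ) * ((m : ℝ) - 1))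

/-- The empirical estimator of the NAMMD. -/
def nammdHat {S : Type*} (H : Type*) [NormedAddCommGroup H] [InnerProductSpace ℝ H]
    [CompleteSpace H] [RKHS ℝ H S ℝ] (K : ℝ) {m : ℕ} (Z : Samples S m) : ℝ :=
  (∑ p ∈ (Finset.univ : Finset (Fin m)).offDiag, hTerm H Z p.1 p.2) /
    ∑ p ∈ (Finset.univ : Finset (Fin m)).offDiag, nTerm H K Z p.1 p.2

/-! ### Asymptotic variances and thresholds -/

/-- `σ_M = √(4 E[H₁₂ H₁₃] - 4 (E H₁₂)²)` under `(P, Q)`. -/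
def sigmaM {S : Type*} [MeasurableSpace S] (H : Type*) [NormedAddCommGroup H]
    [InnerProductSpace ℝ H] [CompleteSpace H] [RKHS ℝ H S ℝ] (P Q : Measure S) : ℝ :=
  √(4 * (∫ Z : Samples S 3, hTerm H Z 0 1 * hTerm H Z 0 2 ∂samplesLaw P Q 3) -
    4 * (∫ Z : Samples S 3, hTerm H Z 0 1 ∂samplesLaw P Q 3) ^ 2)

/-- `G_{i,j} = H_{i,j} - NAMMD(P, Q) (4K - κ(x_i, x_j) - κ(y_i, y_j))`. -/
def gTerm {S : Type*} [MeasurableSpace S] (H : Type*) [NormedAddCommGroup H]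
    [InnerProductSpace ℝ H] [CompleteSpace H] [RKHS ℝ H S ℝ] (K : ℝ) (P Q : Measure S) {m : ℕ}
    (Z : Samples S m) (i j : Fin m) : ℝ :=
  hTerm H Z i j - nammd H K P Q * nTerm H K Z i j

/-- `σ_* = √(4 E[G₁₂ G₁₃] - 4 (E G₁₂)²)` under `(P, Q)`. -/
def sigmaStar {S : Type*} [MeasurableSpace S] (H : Type*) [NormedAddCommGroup H]
    [InnerProductSpace ℝ H] [CompleteSpace H] [RKHS ℝ H S ℝ] (K : ℝ) (P Q : Measure S) : ℝ :=
  √(4 * (∫ Z : Samples S 3, gTerm H K P Q Z 0 1 * gTerm H K P Q Z 0 2 ∂samplesLaw P Q 3) -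
    4 * (∫ Z : Samples S 3, gTerm H K P Q Z 0 1 ∂samplesLaw P Q 3) ^ 2)

/-- The standard normal distribution function `Φ`. -/
def stdNormalCdf (x : ℝ) : ℝ := cdf (gaussianReal 0 1) x

/-- The `(1 - α)`-quantile of the standard normal distribution. -/
def normalQuantile (α : ℝ) : ℝ := sInf {x : ℝ | 1 - α ≤ stdNormalCdf x}

/-- `τ_α^M`, the `(1 - α)`-quantile of the normal law with mean `√m MMD²(P₁, Q₁)` and standard
deviation `σ_M` (under `(P₂, Q₂)`). -/
def tauM {S : Type*} [MeasurableSpace S] (H : Type*) [NormedAddCommGroup H]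
    [InnerProductSpace ℝ H] [CompleteSpace H] [RKHS ℝ H S ℝ] (P₁ Q₁ P₂ Q₂ : Measure S)
    (α : ℝ) (m : ℕ) : ℝ :=
  √(m : ℝ) * mmdSq H P₁ Q₁ + sigmaM H P₂ Q₂ * normalQuantile α

/-- `τ_α^N`, the `(1 - α)`-quantile of the normal law with mean `√m NAMMD(P₁, Q₁)` and standard
deviation `σ_M / NORM(P₂, Q₂)`. -/
def tauN {S : Type*} [MeasurableSpace S] (H : Type*) [NormedAddCommGroup H]
    [InnerProductSpace ℝ H] [CompleteSpace H] [RKHS ℝ H S ℝ] (K : ℝ) (P₁ Q₁ P₂ Q₂ : Measure S)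
    (α : ℝ) (m : ℕ) : ℝ :=
  √(m : ℝ) * nammd H K P₁ Q₁ + sigmaM H P₂ Q₂ / normTerm H K P₂ Q₂ * normalQuantile α

/-- The MMD-based test rejects. -/
def MMDRejects {S : Type*} [MeasurableSpace S] (H : Type*) [NormedAddCommGroup H]
    [InnerProductSpace ℝ H] [CompleteSpace H] [RKHS ℝ H S ℝ] (P₁ Q₁ P₂ Q₂ : Measure S)
    (α : ℝ) {m : ℕ} (Z : Samples S m) : Prop :=
  tauM H P₁ Q₁ P₂ Q₂ α m < √(m : ℝ) * mmdSqHat H Z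

/-- The NAMMD-based test rejects. -/
def NAMMDRejects {S : Type*} [MeasurableSpace S] (H : Type*) [NormedAddCommGroup H]
    [InnerProductSpace ℝ H] [CompleteSpace H] [RKHS ℝ H S ℝ] (K : ℝ) (P₁ Q₁ P₂ Q₂ : Measure S)
    (α : ℝ) {m : ℕ} (Z : Samples S m) : Prop :=
  tauN H K P₁ Q₁ P₂ Q₂ α m < √(m : ℝ) * nammdHat H K Z

/-- The quantity `Δ`. -/
def gapDelta {S : Type*} [MeasurableSpace S] (H : Type*) [NormedAddCommGroup H]
    [InnerProductSpace ℝ H] [CompleteSpace H] [RKHS ℝ H S ℝ] (K : ℝ) (P₁ Q₁ P₂ Q₂ : Measure S)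
    (α : ℝ) (m : ℕ) : ℝ :=
  √(m : ℝ) * nammd H K P₁ Q₁ *
    ((‖meanEmbedding H P₂‖ ^ 2 + ‖meanEmbedding H Q₂‖ ^ 2
        - ‖meanEmbedding H P₁‖ ^ 2 - ‖meanEmbedding H Q₁‖ ^ 2) /
      (√(m : ℝ) * mmdSq H P₁ Q₁ + sigmaM H P₂ Q₂ * normalQuantile α))

/-! ### Normal approximations of the powers, and the window of sample sizes -/

/-- Mass above `τ_α^M` of the normal law with mean `√m MMD²(P₂, Q₂)` and standard deviation
`σ_M`. -/
def normalPowerM {S : Type*} [MeasurableSpace S] (H : Type*) [NormedAddCommGroup H]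
    [InnerProductSpace ℝ H] [CompleteSpace H] [RKHS ℝ H S ℝ] (P₁ Q₁ P₂ Q₂ : Measure S)
    (α : ℝ) (m : ℕ) : ℝ :=
  stdNormalCdf ((√(m : ℝ) * mmdSq H P₂ Q₂ - tauM H P₁ Q₁ P₂ Q₂ α m) / sigmaM H P₂ Q₂)

/-- Mass above `τ_α^N` of the normal law with mean `√m NAMMD(P₂, Q₂)` and standard deviation
`σ_M / NORM(P₂, Q₂)`. -/
def normalPowerN {S : Type*} [MeasurableSpace S] (H : Type*) [NormedAddCommGroup H]
    [InnerProductSpace ℝ H] [CompleteSpace H] [RKHS ℝ H S ℝ] (K : ℝ) (P₁ Q₁ P₂ Q₂ : Measure S)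
    (α : ℝ) (m : ℕ) : ℝ :=
  stdNormalCdf ((√(m : ℝ) * nammd H K P₂ Q₂ - tauN H K P₁ Q₁ P₂ Q₂ α m) /
    (sigmaM H P₂ Q₂ / normTerm H K P₂ Q₂))

/-- The lower end `C₁(s)` of the window of sample sizes, for a standard deviation `s`. -/
def windowLower {S : Type*} [MeasurableSpace S] (H : Type*) [NormedAddCommGroup H]
    [InnerProductSpace ℝ H] [CompleteSpace H] [RKHS ℝ H S ℝ] (K : ℝ) (P₁ Q₁ P₂ Q₂ : Measure S)
    (α s : ℝ) : ℝ :=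
  max ((normalQuantile α * sigmaM H P₂ Q₂ / (mmdSq H P₂ Q₂ - mmdSq H P₁ Q₁)) ^ 2)
    (((0.051 * sigmaM H P₂ Q₂ + 0.751 * max 0 (s - sigmaM H P₂ Q₂)) /
      ((1 - normTerm H K P₂ Q₂ / normTerm H K P₁ Q₁) * mmdSq H P₁ Q₁)) ^ 2)

/-- The upper end `C₂` of the window of sample sizes. -/
def windowUpper {S : Type*} [MeasurableSpace S] (H : Type*) [NormedAddCommGroup H]
    [InnerProductSpace ℝ H] [CompleteSpace H] [RKHS ℝ H S ℝ] (P₁ Q₁ P₂ Q₂ : Measure S)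
    (α : ℝ) : ℝ :=
  ((normalQuantile α + 0.7) * sigmaM H P₂ Q₂ / (mmdSq H P₂ Q₂ - mmdSq H P₁ Q₁)) ^ 2

end NAMMD

end

/-!
All four assertions follow from one comparison of the two thresholds. Write `a` for the distance, in
units of `σ_M`, of `√m M₂` from `τ^M`; then `√m ε₂` exceeds `τ^N` by `(a σ_M + l) / N₂`, where
`l = √m (1 - N₂ / N₁) M₁ > 0` is the gain of the NAMMD test. Moreover `τ^N = τ^M (1 - Δ) / N₂`
(`tauN_eq_tauM_mul`).

*Rejection by the MMD test forces rejection by the NAMMD test.* By this identity the implication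
can only fail when the empirical denominator exceeds `N₂ / (1 - Δ)`. The denominator is `4 K` minus
two independent U-statistics with kernel values in `[0, K]`. Each is an average, over all
permutations of the sample, of means over `m / 2` disjoint pairs, so Hoeffding's lemma bounds its
exponential moments (`hasSubgaussianMGF_uStat`), and adding the two independent contributions leaves
enough room to absorb the rounding of `m / 2` for odd `m`. For `α ≤ 1/2` one has
`Δ ≤ (N₁ - N₂) / N₁`, and this is below `1/2` because
`N₂ ≥ 2 K > N₁ / 2`.

*The normal approximations.* They are `Φ(a)` and `Φ(a + l / σ_M)`. The window gives
`0 ≤ a ≤ 0.7` and `l ≥ 0.051 σ_M` (`window_bounds`), and `Φ(a + 0.051) - Φ(a) > 1/65` for all such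
`a` (`one_div_lt_stdNormalCdf_sub`).

*The probability of disagreement.* The NAMMD test rejects when
`√m (mmdSqHat - ε₂ D) > -(a σ_M + l) D / N₂`, where `D` is the empirical denominator. The left side
is a centred U-statistic with limit variance `σ_*²`, and `D` is close to `N₂` by concentration. With
`P(A ∩ B) ≥ P(A) - P(Bᶜ)` and the central limit theorem for U-statistics the limit of the
probability is at least `Φ(-a) - Φ(-(a σ_M + l) / σ_*)`; the second term of the window, which now
involves `σ_*`, gives `a σ_M + l ≥ (a + 0.051) σ_*`, whatever the order of `σ_M` and `σ_*` (for
`σ_* = 0` the subtracted limit is `0`). Since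
the inequality `> 1/65` is strict, and distribution functions are monotone with continuous limits,
compactness of `[0, 0.7]` makes one `m₀` serve for all `a`, hence for all `α` and all reference pairs
(`eventually_forall_one_div_le`).

The central limit theorem for U-statistics (`tendstoInDistribution_uStat`) is reduced to the one for
independent sums by Hoeffding's decomposition: the remainder after the Hájek projection is
degenerate, so only pairs equal up to order are correlated and its second moment is negligible. These
arguments take place on one probability space, that of an infinite sequence of pairs.
-/

noncomputable section

namespace NAMMD

/-! ### The standard normal distribution -/

theorem stdNormalCdf_mono : Monotone stdNormalCdf := fun _ _ h => monotone_cdf _ h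

theorem gaussianPDFReal_le_of_abs_le {x r : ℝ} (h : |x| ≤ r) :
    gaussianPDFReal 0 1 r ≤ gaussianPDFReal 0 1 x := by
  have h2 : x ^ 2 ≤ r ^ 2 := sq_le_sq' (by linarith [neg_abs_le x]) ((le_abs_self x).trans h)
  simp only [gaussianPDFReal, sub_zero]
  gcongr

theorem stdNormalCdf_sub_eq {u v : ℝ} (h : u ≤ v) :
    stdNormalCdf v - stdNormalCdf u = ∫ x in Set.Ioc u v, gaussianPDFReal 0 1 x := by
  have h1 : (gaussianReal 0 1).real (Set.Ioc u v) = stdNormalCdf v - stdNormalCdf u := by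
    rw [stdNormalCdf, stdNormalCdf, cdf_eq_real, cdf_eq_real, ← Set.Iic_sdiff_Iic,
      measureReal_sdiff (Set.Iic_subset_Iic.2 h) measurableSet_Iic]
  rw [← h1, measureReal_def, gaussianReal_apply_eq_integral _ one_ne_zero, ENNReal.toReal_ofReal]
  exact integral_nonneg fun x => gaussianPDFReal_nonneg _ _ _

/-- The standard normal density is smallest, on `[-r, r]`, at the endpoints. -/
theorem mul_le_stdNormalCdf_sub {u v r : ℝ} (huv : u ≤ v) (hu : -r ≤ u) (hv : v ≤ r) :
    (v - u) * gaussianPDFReal 0 1 r ≤ stdNormalCdf v - stdNormalCdf u := by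
  rw [stdNormalCdf_sub_eq huv]
  have h1 : ∫ _ in Set.Ioc u v, gaussianPDFReal 0 1 r = (v - u) * gaussianPDFReal 0 1 r := by
    rw [setIntegral_const]
    simp [huv]
  rw [← h1]
  refine setIntegral_mono_on (integrable_const _) (integrable_gaussianPDFReal 0 1).integrableOn
    measurableSet_Ioc fun x hx => gaussianPDFReal_le_of_abs_le (abs_le.2 ⟨?_, ?_⟩)
  · linarith [hx.1]
  · linarith [hx.2]

theorem continuous_stdNormalCdf : Continuous stdNormalCdf := by
  have h0 : ∀ x, stdNormalCdf x = stdNormalCdf 0 + ∫ t in (0 : ℝ)..x, gaussianPDFReal 0 1 t := by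
    intro x
    rcases le_total 0 x with h | h
    · rw [intervalIntegral.integral_of_le h, ← stdNormalCdf_sub_eq h]; ring
    · rw [intervalIntegral.integral_of_ge h, ← stdNormalCdf_sub_eq h]; ring
  rw [show stdNormalCdf = _ from funext h0]
  exact continuous_const.add
    (intervalIntegral.continuous_primitive
      (fun a b => (integrable_gaussianPDFReal 0 1).intervalIntegrable) 0)

theorem stdNormalCdf_neg (x : ℝ) : stdNormalCdf (-x) = 1 - stdNormalCdf x := by
  have : NullSingletonClass (gaussianReal 0 1) := nullSingletonClass_gaussianReal one_ne_zero
  have h1 : (gaussianReal 0 1).real (Set.Iic (-x)) = (gaussianReal 0 1).real (Set.Ici x) := by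
    conv_lhs => rw [show gaussianReal 0 1 = (gaussianReal 0 1).map (fun x => -x) by
      rw [gaussianReal_map_neg, neg_zero]]
    rw [map_measureReal_apply (by fun_prop) measurableSet_Iic]
    congr 1
    ext y; simp
  rw [stdNormalCdf, stdNormalCdf, cdf_eq_real, cdf_eq_real, h1, measureReal_congr Ioi_ae_eq_Ici.symm,
    ← Set.compl_Iic, probReal_compl_eq_one_sub measurableSet_Iic]

theorem stdNormalCdf_strictMono : StrictMono stdNormalCdf := by
  intro u v h
  have h1 := mul_le_stdNormalCdf_sub (r := max (-u) v) h.le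
    (by linarith [le_max_left (-u) v]) (le_max_right _ _)
  have h2 : 0 < (v - u) * gaussianPDFReal 0 1 (max (-u) v) :=
    mul_pos (by linarith) (gaussianPDFReal_pos _ _ _ one_ne_zero)
  linarith

theorem stdNormalCdf_zero : stdNormalCdf 0 = 1 / 2 := by
  have := stdNormalCdf_neg 0
  rw [neg_zero] at this
  linarith

theorem normalQuantile_nonneg {α : ℝ} (h : α ≤ 1 / 2) : 0 ≤ normalQuantile α := by
  refine Real.sInf_nonneg fun x hx => ?_
  by_contra! hneg
  have h1 := stdNormalCdf_strictMono hneg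
  rw [stdNormalCdf_zero] at h1
  have : 1 - α ≤ stdNormalCdf x := hx
  linarith

/-- A numerical lower bound for the standard normal density, from the Taylor polynomial of the
exponential. -/
theorem mul_le_gaussianPDFReal {x c : ℝ} (hx0 : 0 ≤ x) (hx1 : x ≤ 1) (hc0 : 0 ≤ c)
    (hc : c ≤ 1 - x ^ 2 / 2 + (x ^ 2 / 2) ^ 2 / 2 - (x ^ 2 / 2) ^ 3 / 6
      - (x ^ 2 / 2) ^ 4 * (5 / 96)) :
    0.398 * c ≤ gaussianPDFReal 0 1 x := by
  have hs : (0.398 : ℝ) ≤ (√(2 * Real.pi * (1 : NNReal)))⁻¹ := by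
    rw [le_inv_comm₀ (by norm_num) (by positivity)]
    refine Real.sqrt_le_iff.2 ⟨by norm_num, ?_⟩
    have := Real.pi_lt_d4
    norm_num
    linarith
  have hx2 : x ^ 2 ≤ 1 := pow_le_one₀ hx0 hx1
  have hy : |-(x ^ 2 / 2)| = x ^ 2 / 2 := by rw [abs_neg, abs_of_nonneg (by positivity)]
  have he := (abs_le.1 (Real.exp_bound (x := -(x ^ 2 / 2)) (by rw [hy]; linarith)
    (n := 4) (by norm_num))).1
  rw [hy] at he
  simp only [Finset.sum_range_succ, Finset.sum_range_zero, Nat.factorial] at he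
  norm_num at he
  simp only [gaussianPDFReal, sub_zero]
  refine mul_le_mul hs ?_ hc0 (by positivity)
  rw [show -x ^ 2 / (2 * ((1 : NNReal) : ℝ)) = -(x ^ 2 / 2) by simp; ring]
  linarith

/-- The increment of `Φ` over an interval of length `0.051` inside `[0, 0.751]` exceeds `1/65`:
`Φ` is concave there, so the worst interval is `[0.7, 0.751]`, where the lower Riemann sum over two
halves is already large enough (the one over the whole interval is not). -/
theorem one_div_lt_stdNormalCdf_sub {a : ℝ} (h0 : 0 ≤ a) (h1 : a ≤ 0.7) :
    1 / 65 < stdNormalCdf (a + 0.051) - stdNormalCdf a := by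
  have e1 := mul_le_stdNormalCdf_sub (u := a) (v := a + 0.0255) (r := 0.7255)
    (by linarith) (by linarith) (by linarith)
  have e2 := mul_le_stdNormalCdf_sub (u := a + 0.0255) (v := a + 0.051) (r := 0.751)
    (by linarith) (by linarith) (by linarith)
  have p1 := mul_le_gaussianPDFReal (x := 0.7255) (c := 0.768) (by norm_num) (by norm_num)
    (by norm_num) (by norm_num)
  have p2 := mul_le_gaussianPDFReal (x := 0.751) (c := 0.753) (by norm_num) (by norm_num)
    (by norm_num) (by norm_num)
  linarith

/-! ### U-statistics of degree two and their exponential tails -/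

/-- The U-statistic of degree two with kernel `f`: the mean of `f (X i) (X j)` over the ordered
pairs `i ≠ j`. -/
def uStat {E : Type*} {m : ℕ} (f : E → E → ℝ) (X : Fin m → E) : ℝ :=
  (∑ p ∈ (Finset.univ : Finset (Fin m)).offDiag, f (X p.1) (X p.2)) / ((m : ℝ) * ((m : ℝ) - 1))

theorem card_offDiag_fin (m : ℕ) :
    (((Finset.univ : Finset (Fin m)).offDiag.card : ℕ) : ℝ) = (m : ℝ) * ((m : ℝ) - 1) := by
  rw [Finset.offDiag_card, Nat.cast_sub (by simpa using Nat.le_mul_self m)]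
  simp
  ring

/-- The average of `f (X (π i)) (X (π j))` over all permutations `π` is the U-statistic, since the
permutations act 2-transitively. -/
theorem sum_perm_eq_uStat {E : Type*} {m : ℕ} (f : E → E → ℝ) (X : Fin m → E) {i j : Fin m}
    (hij : i ≠ j) :
    ∑ π : Equiv.Perm (Fin m), f (X (π i)) (X (π j))
      = (Fintype.card (Equiv.Perm (Fin m)) : ℝ) * uStat f X := by
  have hm : 2 ≤ m := by
    have := i.2; have := j.2
    have : (i : ℕ) ≠ j := fun h => hij (Fin.ext h)
    omega
  have hm' : (2 : ℝ) ≤ m := by exact_mod_cast hm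
  have hconst : ∀ p ∈ (Finset.univ : Finset (Fin m)).offDiag,
      ∑ π : Equiv.Perm (Fin m), f (X (π p.1)) (X (π p.2))
        = ∑ π : Equiv.Perm (Fin m), f (X (π i)) (X (π j)) := by
    intro p hp
    obtain ⟨g, h1, h2⟩ := (MulAction.is_two_pretransitive_iff (G := Equiv.Perm (Fin m))).1
      (Equiv.Perm.isMultiplyPretransitive (Fin m) 2) hij (Finset.mem_offDiag.1 hp).2.2
    rw [← h1, ← h2]
    exact Fintype.sum_equiv (Equiv.mulRight g) _ _ fun π => rfl
  have hperm : ∀ π : Equiv.Perm (Fin m),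
      ∑ p ∈ (Finset.univ : Finset (Fin m)).offDiag, f (X (π p.1)) (X (π p.2))
        = ∑ p ∈ (Finset.univ : Finset (Fin m)).offDiag, f (X p.1) (X p.2) := by
    intro π
    refine Finset.sum_equiv (Equiv.prodCongr π π) (fun p => ?_) fun p _ => rfl
    simp [Finset.mem_offDiag]
  have h := Finset.sum_congr rfl hconst
  rw [Finset.sum_const, Finset.sum_comm, Finset.sum_congr rfl fun π _ => hperm π, Finset.sum_const,
    nsmul_eq_mul, nsmul_eq_mul, card_offDiag_fin] at h
  have h0 : (m : ℝ) * ((m : ℝ) - 1) ≠ 0 := by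
    have : (0 : ℝ) < (m : ℝ) * ((m : ℝ) - 1) := by nlinarith
    exact this.ne'
  rw [uStat, ← mul_div_assoc, eq_div_iff h0, mul_comm, ← h, Finset.card_univ]

theorem measurable_uStat {E : Type*} [MeasurableSpace E] {m : ℕ} {f : E → E → ℝ}
    (hf : Measurable fun p : E × E => f p.1 p.2) :
    Measurable fun X : Fin m → E => uStat f X := by
  unfold uStat
  refine Measurable.div_const (Finset.measurable_sum _ fun p _ => ?_) _
  exact hf.comp (f := fun X : Fin m → E => (X p.1, X p.2)) (by fun_prop)

theorem hasSubgaussianMGF_const_mul {Ω : Type*} [MeasurableSpace Ω] {μ : Measure Ω} {X : Ω → ℝ}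
    {c c' : NNReal} (hX : HasSubgaussianMGF X c μ) (r : ℝ) (hc : (c' : ℝ) = r ^ 2 * c) :
    HasSubgaussianMGF (fun ω => r * X ω) c' μ := by
  have h := hX.const_mul r
  rwa [show (⟨r ^ 2, sq_nonneg r⟩ * c : NNReal) = c' from NNReal.eq (by rw [hc]; rfl)] at h

/-- A mean of sub-Gaussian variables, with no independence, is as sub-Gaussian as its terms. -/
theorem hasSubgaussianMGF_average {Ω ι : Type*} [MeasurableSpace Ω] {μ : Measure Ω}
    [IsProbabilityMeasure μ] [Fintype ι] [Nonempty ι] {X : ι → Ω → ℝ} {c : NNReal}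
    (hX : ∀ i, HasSubgaussianMGF (X i) c μ) :
    HasSubgaussianMGF (fun ω => (Fintype.card ι : ℝ)⁻¹ * ∑ i, X i ω) c μ := by
  classical
  have hsum : ∀ s : Finset ι,
      HasSubgaussianMGF (fun ω => ∑ i ∈ s, X i ω) ((s.card : NNReal) ^ 2 * c) μ := by
    intro s
    induction s using Finset.induction_on with
    | empty => simp
    | insert i s his ih =>
      have h := (hX i).add ih
      simp only [Finset.sum_insert his, Finset.card_insert_of_notMem his]
      convert h using 1
      rw [NNReal.sqrt_mul, NNReal.sqrt_sq]
      have := NNReal.sq_sqrt c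
      push_cast
      calc ((s.card : NNReal) + 1) ^ 2 * c = ((s.card : NNReal) + 1) ^ 2 * (NNReal.sqrt c) ^ 2 := by
            rw [this]
        _ = _ := by ring
  refine hasSubgaussianMGF_const_mul (hsum Finset.univ) _ ?_
  have : (Fintype.card ι : ℝ) ≠ 0 := by simp
  push_cast
  rw [Finset.card_univ]
  field_simp

/-- The exponential moments of the centred sum of `f` over `n` disjoint pairs of independent points:
the terms are independent, and each is controlled by Hoeffding's lemma. -/
theorem hasSubgaussianMGF_sum_pairs {E : Type*} [MeasurableSpace E] (P : Measure E)
    [IsProbabilityMeasure P] {f : E → E → ℝ} (hf : Measurable fun p : E × E => f p.1 p.2)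
    {a b : ℝ} (hab : ∀ x y, f x y ∈ Set.Icc a b) {m n : ℕ} (φ : Fin n × Fin 2 → Fin m)
    (hφ : Function.Injective φ) :
    HasSubgaussianMGF
      (fun X : Fin m → E => ∑ k : Fin n,
        (f (X (φ (k, 0))) (X (φ (k, 1))) - ∫ p, f p.1 p.2 ∂(P.prod P)))
      (n * (‖b - a‖₊ / 2) ^ 2) (Measure.pi fun _ => P) := by
  set ν : Measure (Fin 2 → E) := Measure.infinitePi fun _ => P with hν
  have hm2 : Measurable fun v : Fin 2 → E => f (v 0) (v 1) :=
    hf.comp (f := fun v : Fin 2 → E => (v 0, v 1)) (by fun_prop)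
  have hθ : ∫ v, f (v 0) (v 1) ∂ν = ∫ p, f p.1 p.2 ∂(P.prod P) := by
    rw [← Measure.infinitePi_map_eval_prod (P := fun _ : Fin 2 => P) (i := 0) (j := 1) (by simp),
      integral_map (by fun_prop) hf.aestronglyMeasurable]
  have h1 : HasSubgaussianMGF (fun v : Fin 2 → E => f (v 0) (v 1) - ∫ p, f p.1 p.2 ∂(P.prod P))
      ((‖b - a‖₊ / 2) ^ 2) ν := by
    rw [← hθ]
    exact hasSubgaussianMGF_of_mem_Icc hm2.aemeasurable (ae_of_all _ fun v => hab _ _)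
  have hind := iIndepFun_infinitePi (P := fun _ : Fin n => ν)
    (X := fun _ v => f (v 0) (v 1) - ∫ p, f p.1 p.2 ∂(P.prod P)) (fun _ => hm2.sub_const _)
  have h2 := HasSubgaussianMGF.sum_of_iIndepFun hind (c := fun _ => (‖b - a‖₊ / 2) ^ 2)
    (s := Finset.univ) fun k _ => by
      have hk := (measurePreserving_eval_infinitePi (fun _ : Fin n => ν) k)
      refine HasSubgaussianMGF.of_map (Y := fun w : Fin n → Fin 2 → E => w k)
        (X := fun v => f (v 0) (v 1) - ∫ p, f p.1 p.2 ∂(P.prod P)) hk.measurable.aemeasurable ?_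
      rw [Measure.infinitePi_map_eval]
      exact h1
  have hmap : (Measure.pi fun _ : Fin m => P).map (fun X k j => X (φ (k, j)))
      = Measure.infinitePi fun _ : Fin n => ν := by
    rw [hν, ← Measure.infinitePi_map_curry (ι := Fin n) (κ := Fin 2) (fun _ _ => P),
      ← Measure.infinitePi_eq_pi,
      ← Measure.map_infinitePi_infinitePi_of_inj (P := fun _ : Fin m => P) hφ,
      Measure.map_map (by fun_prop) (by fun_prop)]
    rfl
  rw [← hmap] at h2
  have h3 := HasSubgaussianMGF.of_map
    (Y := fun (X : Fin m → E) (k : Fin n) (j : Fin 2) => X (φ (k, j)))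
    (measurable_pi_lambda _ fun k => measurable_pi_lambda _ fun j =>
      measurable_pi_apply _).aemeasurable h2
  simpa [Function.comp_def] using h3

/-- **Hoeffding's bound for U-statistics.** The U-statistic is the average, over the permutations of
the sample, of means over `m / 2` disjoint (hence independent) pairs. -/
theorem hasSubgaussianMGF_uStat {E : Type*} [MeasurableSpace E] (P : Measure E)
    [IsProbabilityMeasure P] {f : E → E → ℝ} (hf : Measurable fun p : E × E => f p.1 p.2)
    {a b : ℝ} (hab : ∀ x y, f x y ∈ Set.Icc a b) {m : ℕ} (hm : 2 ≤ m) :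
    HasSubgaussianMGF (fun X : Fin m → E => uStat f X - ∫ p, f p.1 p.2 ∂(P.prod P))
      ((‖b - a‖₊ / 2) ^ 2 / (m / 2 : ℕ)) (Measure.pi fun _ => P) := by
  set n := m / 2 with hn
  have hn0 : 0 < n := by omega
  set θ := ∫ p, f p.1 p.2 ∂(P.prod P)
  let φ : Fin n × Fin 2 → Fin m := fun q => ⟨2 * q.1 + q.2, by have := q.1.2; have := q.2.2; omega⟩
  have hφ : Function.Injective φ := by
    rintro ⟨k, i⟩ ⟨l, j⟩ h
    have h' : 2 * (k : ℕ) + i = 2 * l + j := congrArg Fin.val h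
    have := i.2; have := j.2
    ext <;> simp <;> omega
  have hn0' : (n : ℝ) ≠ 0 := by exact_mod_cast hn0.ne'
  have h1 := hasSubgaussianMGF_average fun π : Equiv.Perm (Fin m) =>
    hasSubgaussianMGF_const_mul (c' := (‖b - a‖₊ / 2) ^ 2 / n)
      (hasSubgaussianMGF_sum_pairs P hf hab (π ∘ φ) (π.injective.comp hφ)) (n : ℝ)⁻¹ (by
        push_cast
        field_simp)
  convert h1 using 1
  funext X
  have h2 : ∀ k : Fin n, ∑ π : Equiv.Perm (Fin m), f (X (π (φ (k, 0)))) (X (π (φ (k, 1))))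
        = (Fintype.card (Equiv.Perm (Fin m)) : ℝ) * uStat f X := fun k =>
    sum_perm_eq_uStat f X (hφ.ne (by simp))
  have hc : (Fintype.card (Equiv.Perm (Fin m)) : ℝ) ≠ 0 := by simp
  simp only [Function.comp_apply, ← Finset.mul_sum, Finset.sum_sub_distrib]
  rw [Finset.sum_comm, Finset.sum_congr rfl fun k _ => h2 k]
  simp only [Finset.sum_const, Finset.card_univ, nsmul_eq_mul, Fintype.card_fin]
  field_simp
  rfl

/-! ### The central limit theorem for U-statistics -/

section clt

variable {E : Type*} [MeasurableSpace E] (ρ : Measure E) [IsProbabilityMeasure ρ]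

/-- Redrawing one coordinate of an i.i.d. sequence does not change its law. -/
theorem measurePreserving_update_infinitePi (k : ℕ) :
    MeasurePreserving (fun p : (ℕ → E) × E => Function.update p.1 k p.2)
      ((Measure.infinitePi fun _ : ℕ => ρ).prod ρ) (Measure.infinitePi fun _ : ℕ => ρ) := by
  have hmeas : Measurable fun p : (ℕ → E) × E => Function.update p.1 k p.2 := by
    refine measurable_pi_lambda _ fun i => ?_
    by_cases hi : i = k
    · subst hi; simpa using measurable_snd
    · simp only [Function.update_of_ne hi]; fun_prop
  refine ⟨hmeas, Measure.eq_infinitePi _ fun s t ht => ?_⟩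
  have hs : MeasurableSet (Set.pi (s : Set ℕ) t) :=
    MeasurableSet.pi s.countable_toSet fun i _ => ht i
  rw [Measure.map_apply hmeas hs]
  have hpre : (fun p : (ℕ → E) × E => Function.update p.1 k p.2) ⁻¹' Set.pi (s : Set ℕ) t
      = Set.pi ((s.erase k : Finset ℕ) : Set ℕ) t ×ˢ (if k ∈ s then t k else Set.univ) := by
    ext ⟨ω, e⟩
    simp only [Set.mem_preimage, Set.mem_pi, Finset.mem_coe, Set.mem_prod, Finset.mem_erase]
    constructor
    · intro h
      refine ⟨fun i hi => by simpa [Function.update_of_ne hi.1] using h i hi.2, ?_⟩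
      split_ifs with hk
      · simpa using h k hk
      · trivial
    · rintro ⟨h1, h2⟩ i hi
      by_cases hik : i = k
      · subst hik; simpa [hi] using h2
      · simpa [Function.update_of_ne hik] using h1 i ⟨hik, hi⟩
  rw [hpre, Measure.prod_prod, Measure.infinitePi_pi _ fun i _ => ht i]
  by_cases hk : k ∈ s
  · rw [if_pos hk, Finset.prod_erase_mul _ _ hk]
  · rw [if_neg hk, Finset.erase_eq_of_notMem hk, measure_univ, mul_one]

theorem integral_update_infinitePi (k : ℕ) {F : (ℕ → E) → ℝ} (hF : Measurable F) {C : ℝ}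
    (hC : ∀ ω, |F ω| ≤ C) :
    ∫ ω, F ω ∂(Measure.infinitePi fun _ : ℕ => ρ)
      = ∫ ω, ∫ e, F (Function.update ω k e) ∂ρ ∂(Measure.infinitePi fun _ : ℕ => ρ) := by
  have h := measurePreserving_update_infinitePi ρ k
  rw [← h.map_eq, integral_map h.measurable.aemeasurable hF.aestronglyMeasurable, integral_prod,
    h.map_eq]
  exact Integrable.of_bound (hF.comp h.measurable).aestronglyMeasurable C
    (ae_of_all _ fun p => hC _)

variable {ρ}

theorem measurable_eval_pair {g : E → E → ℝ} (hg : Measurable fun p : E × E => g p.1 p.2)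
    (i j : ℕ) : Measurable fun ω : ℕ → E => g (ω i) (ω j) :=
  hg.comp (f := fun ω : ℕ → E => (ω i, ω j)) (by fun_prop)

theorem abs_mul_le_of_abs_le {x y a b : ℝ} (hx : |x| ≤ a) (hy : |y| ≤ b) : |x * y| ≤ a * b := by
  rw [abs_mul]
  exact mul_le_mul hx hy (abs_nonneg _) ((abs_nonneg _).trans hx)

theorem integral_eval_pair {g : E → E → ℝ} (hg : Measurable fun p : E × E => g p.1 p.2)
    {i j : ℕ} (hij : i ≠ j) :
    ∫ ω, g (ω i) (ω j) ∂(Measure.infinitePi fun _ : ℕ => ρ) = ∫ p, g p.1 p.2 ∂(ρ.prod ρ) := by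
  rw [← Measure.infinitePi_map_eval_prod (P := fun _ : ℕ => ρ) hij,
    integral_map (by fun_prop) hg.aestronglyMeasurable]

/-- A product of two kernel values vanishes in mean once one of the four indices, at which the
second kernel is degenerate, occurs nowhere else. -/
theorem integral_mul_eval_eq_zero {g g' : E → E → ℝ} (hg : Measurable fun p : E × E => g p.1 p.2)
    (hg' : Measurable fun p : E × E => g' p.1 p.2) {C C' : ℝ} (hC : ∀ x y, |g x y| ≤ C)
    (hC' : ∀ x y, |g' x y| ≤ C') (hdeg : ∀ y, ∫ x, g' x y ∂ρ = 0) {i j k l : ℕ} (hki : i ≠ k)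
    (hkj : j ≠ k) (hkl : l ≠ k) :
    ∫ ω, g (ω i) (ω j) * g' (ω k) (ω l) ∂(Measure.infinitePi fun _ : ℕ => ρ) = 0 := by
  rw [integral_update_infinitePi ρ k (F := fun ω => g (ω i) (ω j) * g' (ω k) (ω l))
    ((measurable_eval_pair hg i j).mul (measurable_eval_pair hg' k l)) (C := C * C')
    fun ω => abs_mul_le_of_abs_le (hC _ _) (hC' _ _)]
  simp [Function.update_of_ne hki, Function.update_of_ne hkj, Function.update_of_ne hkl,
    integral_const_mul, hdeg]

/-- The second moment of a sum of degenerate kernel values grows only like the number of pairs: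
two pairs are uncorrelated unless they are equal up to order. -/
theorem integral_sq_sum_offDiag_le {g : E → E → ℝ} (hg : Measurable fun p : E × E => g p.1 p.2)
    {C : ℝ} (hC : ∀ x y, |g x y| ≤ C) (hdeg₁ : ∀ y, ∫ x, g x y ∂ρ = 0)
    (hdeg₂ : ∀ x, ∫ y, g x y ∂ρ = 0) (m : ℕ) :
    ∫ ω, (∑ p ∈ (Finset.univ : Finset (Fin m)).offDiag, g (ω p.1) (ω p.2)) ^ 2
        ∂(Measure.infinitePi fun _ : ℕ => ρ)
      ≤ 2 * C ^ 2 * ((m : ℝ) * ((m : ℝ) - 1)) := by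
  set I := (Finset.univ : Finset (Fin m)).offDiag with hI
  have hmeas : ∀ p q : Fin m × Fin m,
      Measurable fun ω : ℕ → E => g (ω p.1) (ω p.2) * g (ω q.1) (ω q.2) := fun p q =>
    (measurable_eval_pair hg _ _).mul (measurable_eval_pair hg _ _)
  have hbd : ∀ (p q : Fin m × Fin m) (ω : ℕ → E),
      |g (ω p.1) (ω p.2) * g (ω q.1) (ω q.2)| ≤ C * C := fun p q ω =>
    abs_mul_le_of_abs_le (hC _ _) (hC _ _)
  have hint : ∀ p q : Fin m × Fin m,
      Integrable (fun ω : ℕ → E => g (ω p.1) (ω p.2) * g (ω q.1) (ω q.2))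
        (Measure.infinitePi fun _ : ℕ => ρ) := fun p q =>
    Integrable.of_bound (hmeas p q).aestronglyMeasurable (C * C) (ae_of_all _ (hbd p q))
  have hexp : ∀ ω : ℕ → E, (∑ p ∈ I, g (ω p.1) (ω p.2)) ^ 2
      = ∑ p ∈ I, ∑ q ∈ I, g (ω p.1) (ω p.2) * g (ω q.1) (ω q.2) := fun ω => by
    rw [sq, Finset.sum_mul_sum]
  simp only [hexp]
  rw [integral_finsetSum _ fun p _ => integrable_finsetSum _ fun q _ => hint p q]
  have hrow : ∀ p ∈ I, ∫ ω, ∑ q ∈ I, g (ω p.1) (ω p.2) * g (ω q.1) (ω q.2)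
      ∂(Measure.infinitePi fun _ : ℕ => ρ) ≤ 2 * C ^ 2 := by
    intro p hp
    rw [integral_finsetSum _ fun q _ => hint p q]
    have hsub : ({p, p.swap} : Finset (Fin m × Fin m)) ⊆ I := by
      have := (Finset.mem_offDiag.1 hp).2.2
      intro q hq
      rcases Finset.mem_insert.1 hq with rfl | hq
      · exact hp
      · rw [Finset.mem_singleton.1 hq]
        simpa [hI] using this.symm
    rw [← Finset.sum_subset hsub]
    · refine (Finset.sum_le_card_nsmul _ _ (C * C) fun q _ => ?_).trans ?_
      · have h := norm_integral_le_of_norm_le_const (μ := Measure.infinitePi fun _ : ℕ => ρ)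
          (ae_of_all _ fun ω => (Real.norm_eq_abs _).trans_le (hbd p q ω))
        rw [probReal_univ, mul_one] at h
        exact (le_abs_self _).trans h
      · have hcard : ((({p, p.swap} : Finset (Fin m × Fin m)).card : ℕ) : ℝ) ≤ 2 := by
          exact_mod_cast Finset.card_le_two
        rw [nsmul_eq_mul]
        nlinarith [mul_self_nonneg C]
    · intro q hq hqp
      have hp' := (Finset.mem_offDiag.1 hp).2.2
      have hq' := (Finset.mem_offDiag.1 hq).2.2
      by_cases h1 : p.1 ≠ q.1 ∧ p.2 ≠ q.1
      · exact integral_mul_eval_eq_zero hg hg hC hC hdeg₁ (Fin.val_injective.ne h1.1)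
          (Fin.val_injective.ne h1.2) (Fin.val_injective.ne hq'.symm)
      · have h2 : p.1 ≠ q.2 ∧ p.2 ≠ q.2 := by
          simp only [Finset.mem_insert, Finset.mem_singleton, Prod.ext_iff, Prod.fst_swap,
            Prod.snd_swap] at hqp
          grind
        exact integral_mul_eval_eq_zero (g' := fun x y => g y x) hg (hg.comp measurable_swap) hC
          (fun x y => hC y x) hdeg₂ (Fin.val_injective.ne h2.1) (Fin.val_injective.ne h2.2)
          (Fin.val_injective.ne hq')
  refine (Finset.sum_le_sum hrow).trans_eq ?_
  rw [Finset.sum_const, nsmul_eq_mul, card_offDiag_fin, mul_comm]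

theorem sum_offDiag_fst {m : ℕ} (F : Fin m → ℝ) :
    ∑ p ∈ (Finset.univ : Finset (Fin m)).offDiag, F p.1 = ((m : ℝ) - 1) * ∑ i, F i := by
  have h := Finset.sum_union (f := fun p : Fin m × Fin m => F p.1)
    (Finset.disjoint_diag_offDiag (Finset.univ : Finset (Fin m)))
  rw [Finset.diag_union_offDiag, Finset.sum_product, Finset.sum_diag] at h
  simp only [Finset.sum_const, Finset.card_univ, Fintype.card_fin, nsmul_eq_mul,
    ← Finset.mul_sum] at h
  linarith

theorem sum_offDiag_snd {m : ℕ} (F : Fin m → ℝ) :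
    ∑ p ∈ (Finset.univ : Finset (Fin m)).offDiag, F p.2 = ((m : ℝ) - 1) * ∑ i, F i := by
  rw [← sum_offDiag_fst]
  exact Finset.sum_equiv (Equiv.prodComm _ _) (fun p => by simp [Finset.mem_offDiag, eq_comm])
    fun p _ => rfl

/-- The (uncentred) first-order Hájek projection `x ↦ E h(x, Y)`, `Y ∼ ρ`, of the kernel `h`. -/
def proj (ρ : Measure E) (h : E → E → ℝ) (x : E) : ℝ := ∫ y, h x y ∂ρ

theorem measurable_proj {h : E → E → ℝ} (hh : Measurable fun p : E × E => h p.1 p.2) :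
    Measurable (proj ρ h) :=
  (hh.stronglyMeasurable.integral_prod_right (ν := ρ)).measurable

theorem abs_proj_le {h : E → E → ℝ} {B : ℝ} (hB : ∀ x y, |h x y| ≤ B) (x : E) :
    |proj ρ h x| ≤ B := by
  have := norm_integral_le_of_norm_le_const (μ := ρ) (f := h x) (ae_of_all _ (hB x))
  rwa [probReal_univ, mul_one] at this

theorem integrable_of_abs_le {Ω : Type*} [MeasurableSpace Ω] {μ : Measure Ω} [IsFiniteMeasure μ]
    {F : Ω → ℝ} (hF : Measurable F) {C : ℝ} (hC : ∀ ω, |F ω| ≤ C) : Integrable F μ :=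
  Integrable.of_bound hF.aestronglyMeasurable C (ae_of_all _ hC)

theorem integral_proj {h : E → E → ℝ} (hh : Measurable fun p : E × E => h p.1 p.2) {B : ℝ}
    (hB : ∀ x y, |h x y| ≤ B) : ∫ x, proj ρ h x ∂ρ = ∫ p, h p.1 p.2 ∂(ρ.prod ρ) :=
  (integral_prod _ (integrable_of_abs_le hh fun p => hB p.1 p.2)).symm

/-- Two kernel values sharing exactly one point have covariance `Var (proj h)`. -/
theorem integral_mul_eval_shared {h : E → E → ℝ} (hh : Measurable fun p : E × E => h p.1 p.2)
    {B : ℝ} (hB : ∀ x y, |h x y| ≤ B) :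
    (∫ ω, h (ω 0) (ω 1) * h (ω 0) (ω 2) ∂(Measure.infinitePi fun _ : ℕ => ρ))
      - (∫ p, h p.1 p.2 ∂(ρ.prod ρ)) ^ 2 = Var[proj ρ h; ρ] := by
  have hm := measurable_proj (ρ := ρ) hh
  have hb := abs_proj_le (ρ := ρ) hB
  rw [integral_update_infinitePi ρ 2 (F := fun ω => h (ω 0) (ω 1) * h (ω 0) (ω 2))
    ((measurable_eval_pair hh _ _).mul (measurable_eval_pair hh _ _)) (C := B * B)
    fun ω => abs_mul_le_of_abs_le (hB _ _) (hB _ _)]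
  have e1 : ∀ ω : ℕ → E, ∫ e, h (Function.update ω 2 e 0) (Function.update ω 2 e 1)
      * h (Function.update ω 2 e 0) (Function.update ω 2 e 2) ∂ρ
      = h (ω 0) (ω 1) * proj ρ h (ω 0) := by
    intro ω
    simp [integral_const_mul, proj]
  simp only [e1]
  rw [integral_update_infinitePi ρ 1 (F := fun ω => h (ω 0) (ω 1) * proj ρ h (ω 0))
    ((measurable_eval_pair hh _ _).mul (hm.comp (measurable_pi_apply 0))) (C := B * B)
    fun ω => abs_mul_le_of_abs_le (hB _ _) (hb _)]
  have e2 : ∀ ω : ℕ → E, ∫ e, h (Function.update ω 1 e 0) (Function.update ω 1 e 1)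
      * proj ρ h (Function.update ω 1 e 0) ∂ρ = proj ρ h (ω 0) ^ 2 := by
    intro ω
    simp only [Function.update_self, Function.update_of_ne (show (0 : ℕ) ≠ 1 by norm_num),
      integral_mul_const, sq]
    rfl
  simp only [e2]
  rw [variance_eq_sub (MemLp.of_bound hm.aestronglyMeasurable B (ae_of_all _ hb)),
    integral_proj hh hB, ← Measure.infinitePi_map_eval (fun _ : ℕ => ρ) 0,
    integral_map (measurable_pi_apply 0).aemeasurable (by
      rw [Measure.infinitePi_map_eval]
      exact (hm.pow_const 2).aestronglyMeasurable), Measure.infinitePi_map_eval]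
  rfl

/-- The degenerate part of the kernel `h`, left over after its Hájek projection. -/
def degPart (ρ : Measure E) (h : E → E → ℝ) (x y : E) : ℝ :=
  h x y - proj ρ h x - proj ρ h y + ∫ p, h p.1 p.2 ∂(ρ.prod ρ)

theorem measurable_degPart {h : E → E → ℝ} (hh : Measurable fun p : E × E => h p.1 p.2) :
    Measurable fun p : E × E => degPart ρ h p.1 p.2 := by
  have hm := measurable_proj (ρ := ρ) hh
  unfold degPart
  fun_prop

theorem abs_degPart_le {h : E → E → ℝ} {B : ℝ} (hB : ∀ x y, |h x y| ≤ B) (x y : E) :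
    |degPart ρ h x y| ≤ 4 * B := by
  have h1 := abs_le.1 (hB x y)
  have h2 := abs_le.1 (abs_proj_le (ρ := ρ) hB x)
  have h3 := abs_le.1 (abs_proj_le (ρ := ρ) hB y)
  have h4 := norm_integral_le_of_norm_le_const (μ := ρ.prod ρ) (f := fun p : E × E => h p.1 p.2)
    (ae_of_all _ fun p => hB p.1 p.2)
  rw [probReal_univ, mul_one, Real.norm_eq_abs] at h4
  have h4 := abs_le.1 h4
  rw [degPart, abs_le]
  constructor <;> linarith [h1.1, h1.2, h2.1, h2.2, h3.1, h3.2, h4.1, h4.2]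

theorem integral_degPart_right {h : E → E → ℝ} (hh : Measurable fun p : E × E => h p.1 p.2)
    {B : ℝ} (hB : ∀ x y, |h x y| ≤ B) (x : E) : ∫ y, degPart ρ h x y ∂ρ = 0 := by
  have i1 : Integrable (fun y => h x y) ρ :=
    integrable_of_abs_le (hh.comp measurable_prodMk_left) (hB x)
  have i2 : Integrable (fun y => proj ρ h y) ρ :=
    integrable_of_abs_le (measurable_proj hh) (abs_proj_le hB)
  simp only [degPart]
  rw [integral_add (f := fun y => h x y - proj ρ h x - proj ρ h y)
      ((i1.sub (integrable_const _)).sub i2) (integrable_const _),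
    integral_sub (f := fun y => h x y - proj ρ h x) (i1.sub (integrable_const _)) i2,
    integral_sub i1 (integrable_const _), integral_proj hh hB]
  simp [proj]

theorem integral_degPart_left {h : E → E → ℝ} (hh : Measurable fun p : E × E => h p.1 p.2)
    {B : ℝ} (hB : ∀ x y, |h x y| ≤ B) (hsymm : ∀ x y, h x y = h y x) (y : E) :
    ∫ x, degPart ρ h x y ∂ρ = 0 := by
  rw [← integral_degPart_right (ρ := ρ) hh hB y]
  congr with x
  rw [degPart, degPart, hsymm x y]
  ring

/-- Hoeffding's decomposition: the centred U-statistic is its Hájek projection plus a degenerate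
remainder. -/
theorem uStat_sub_eq {h : E → E → ℝ} {m : ℕ} (ν : Measure E) (hm : 2 ≤ m) (ω : ℕ → E) :
    √(m : ℝ) * (uStat h (fun i : Fin m => ω i) - ∫ p, h p.1 p.2 ∂(ν.prod ν))
      - (√(m : ℝ))⁻¹ * (∑ k ∈ Finset.range m, 2 * proj ν h (ω k)
          - m * (2 * ∫ p, h p.1 p.2 ∂(ν.prod ν)))
      = √(m : ℝ) / ((m : ℝ) * ((m : ℝ) - 1))
        * ∑ p ∈ (Finset.univ : Finset (Fin m)).offDiag, degPart ν h (ω p.1) (ω p.2) := by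
  have hm' : (2 : ℝ) ≤ m := by exact_mod_cast hm
  set θ := ∫ p, h p.1 p.2 ∂(ν.prod ν) with hθ
  have hsum : ∑ p ∈ (Finset.univ : Finset (Fin m)).offDiag, degPart ν h (ω p.1) (ω p.2)
      = ∑ p ∈ (Finset.univ : Finset (Fin m)).offDiag, h (ω p.1) (ω p.2)
        - 2 * (((m : ℝ) - 1) * ∑ i : Fin m, proj ν h (ω i)) + (m : ℝ) * ((m : ℝ) - 1) * θ := by
    simp only [degPart, Finset.sum_add_distrib, Finset.sum_sub_distrib]
    rw [sum_offDiag_fst fun i : Fin m => proj ν h (ω i),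
      sum_offDiag_snd fun i : Fin m => proj ν h (ω i), Finset.sum_const, nsmul_eq_mul,
      card_offDiag_fin]
    ring
  rw [hsum, ← Finset.mul_sum, Finset.sum_range, uStat]
  have h1 : (m : ℝ) - 1 ≠ 0 := by linarith
  have hs : √(m : ℝ) ≠ 0 := (Real.sqrt_pos.2 (by linarith)).ne'
  have hsq : (m : ℝ) = √(m : ℝ) ^ 2 := (Real.sq_sqrt (by linarith)).symm
  generalize √(m : ℝ) = s at *
  rw [hsq] at h1 ⊢
  field_simp
  ring

/-- The variance of the limit law of the U-statistic with kernel `h`. -/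
def limitVar (ρ : Measure E) (h : E → E → ℝ) : ℝ := 4 * Var[proj ρ h; ρ]

/-- The central limit theorem for the Hájek projection. -/
theorem tendstoInDistribution_proj {h : E → E → ℝ} (hh : Measurable fun p : E × E => h p.1 p.2)
    {B : ℝ} (hB : ∀ x y, |h x y| ≤ B) :
    TendstoInDistribution
      (fun (m : ℕ) (ω : ℕ → E) => (√(m : ℝ))⁻¹ * (∑ k ∈ Finset.range m, 2 * proj ρ h (ω k)
          - m * (2 * ∫ p, h p.1 p.2 ∂(ρ.prod ρ))))
      atTop (id : ℝ → ℝ) (fun _ => Measure.infinitePi fun _ : ℕ => ρ)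
      (gaussianReal 0 (limitVar ρ h).toNNReal) := by
  have hpm := measurable_proj (ρ := ρ) hh
  have hpb := abs_proj_le (ρ := ρ) hB
  have hm2 : Measurable fun x => 2 * proj ρ h x := hpm.const_mul 2
  have hind : iIndepFun (fun (k : ℕ) (ω : ℕ → E) => 2 * proj ρ h (ω k))
      (Measure.infinitePi fun _ : ℕ => ρ) :=
    iIndepFun_infinitePi (P := fun _ : ℕ => ρ) (X := fun _ x => 2 * proj ρ h x) fun _ => hm2
  have hev : ∀ k : ℕ, MeasurePreserving (fun ω : ℕ → E => ω k)
      (Measure.infinitePi fun _ : ℕ => ρ) ρ := fun k =>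
    measurePreserving_eval_infinitePi (fun _ : ℕ => ρ) k
  have hident : ∀ k : ℕ, IdentDistrib (fun ω : ℕ → E => 2 * proj ρ h (ω k))
      (fun ω : ℕ → E => 2 * proj ρ h (ω 0)) (Measure.infinitePi fun _ : ℕ => ρ)
      (Measure.infinitePi fun _ : ℕ => ρ) := by
    intro k
    have : IdentDistrib (fun ω : ℕ → E => ω k) (fun ω : ℕ → E => ω 0)
        (Measure.infinitePi fun _ : ℕ => ρ) (Measure.infinitePi fun _ : ℕ => ρ) :=
      ⟨(hev k).aemeasurable, (hev 0).aemeasurable, by rw [(hev k).map_eq, (hev 0).map_eq]⟩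
    exact this.comp hm2
  have hlaw : IdentDistrib (fun ω : ℕ → E => 2 * proj ρ h (ω 0)) (fun x => 2 * proj ρ h x)
      (Measure.infinitePi fun _ : ℕ => ρ) ρ := by
    have : IdentDistrib (fun ω : ℕ → E => ω 0) id (Measure.infinitePi fun _ : ℕ => ρ) ρ :=
      ⟨(hev 0).aemeasurable, aemeasurable_id, by rw [(hev 0).map_eq, Measure.map_id]⟩
    exact this.comp hm2
  have hmean : ∫ ω, 2 * proj ρ h (ω 0) ∂(Measure.infinitePi fun _ : ℕ => ρ)
      = 2 * ∫ p, h p.1 p.2 ∂(ρ.prod ρ) := by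
    rw [hlaw.integral_eq, integral_const_mul, integral_proj hh hB]
  have hvar : Var[fun ω : ℕ → E => 2 * proj ρ h (ω 0); Measure.infinitePi fun _ : ℕ => ρ]
      = limitVar ρ h := by
    rw [hlaw.variance_eq, variance_const_mul, limitVar]; norm_num
  have hclt := tendstoInDistribution_inv_sqrt_mul_sum_sub
    (P := Measure.infinitePi fun _ : ℕ => ρ)
    (P' := gaussianReal 0 (limitVar ρ h).toNNReal) (Y := (id : ℝ → ℝ))
    (X := fun (k : ℕ) (ω : ℕ → E) => 2 * proj ρ h (ω k))
    (by rw [hvar]; exact HasLaw.id)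
    (MemLp.of_bound (hm2.comp (hev 0).measurable).aestronglyMeasurable (2 * B)
      (ae_of_all _ fun ω => by
        rw [Real.norm_eq_abs, abs_mul, abs_two]
        exact mul_le_mul_of_nonneg_left (hpb _) zero_le_two)) hind hident
  rw [hmean] at hclt
  exact hclt

/-- The degenerate remainder of the U-statistic is negligible on the scale `√m`: its second moment
is of order `1 / m ^ 2`. -/
theorem tendstoInMeasure_degPart {h : E → E → ℝ} (hh : Measurable fun p : E × E => h p.1 p.2)
    {B : ℝ} (hB : ∀ x y, |h x y| ≤ B) (hsymm : ∀ x y, h x y = h y x) :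
    TendstoInMeasure (Measure.infinitePi fun _ : ℕ => ρ) (fun (m : ℕ) (ω : ℕ → E) =>
      √(m : ℝ) / ((m : ℝ) * ((m : ℝ) - 1))
        * ∑ p ∈ (Finset.univ : Finset (Fin m)).offDiag, degPart ρ h (ω p.1) (ω p.2)) atTop
      (0 : (ℕ → E) → ℝ) := by
  rw [tendstoInMeasure_iff_measureReal_norm]
  intro ε hε
  have hlim : Tendsto (fun m : ℕ => 2 * (4 * B) ^ 2 / ε ^ 2 * ((m : ℝ) - 1)⁻¹) atTop (𝓝 0) := by
    have h := (tendsto_inv_atTop_zero.comp (tendsto_atTop_add_const_right atTop (-1 : ℝ)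
      tendsto_natCast_atTop_atTop)).const_mul (2 * (4 * B) ^ 2 / ε ^ 2)
    rw [mul_zero] at h
    exact h
  refine tendsto_of_tendsto_of_tendsto_of_le_of_le' tendsto_const_nhds hlim
    (Eventually.of_forall fun m => measureReal_nonneg) ?_
  filter_upwards [eventually_ge_atTop 2] with m hm
  have hm' : (2 : ℝ) ≤ m := by exact_mod_cast hm
  set R : (ℕ → E) → ℝ := fun ω =>
    ∑ p ∈ (Finset.univ : Finset (Fin m)).offDiag, degPart ρ h (ω p.1) (ω p.2) with hR
  have hmom := integral_sq_sum_offDiag_le (measurable_degPart (ρ := ρ) hh)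
    (abs_degPart_le hB) (integral_degPart_left hh hB hsymm) (integral_degPart_right hh hB) m
  have hRm : Measurable R := Finset.measurable_sum _ fun p _ =>
    measurable_eval_pair (measurable_degPart hh) _ _
  have hRb : ∀ ω, |R ω| ≤ (Finset.univ : Finset (Fin m)).offDiag.card • (4 * B) := fun ω =>
    (Finset.abs_sum_le_sum_abs _ _).trans
      (Finset.sum_le_card_nsmul _ _ _ fun p _ => abs_degPart_le hB _ _)
  change ∫ ω, R ω ^ 2 ∂_ ≤ _ at hmom
  change Measure.real _ {ω | ε ≤ ‖√(m : ℝ) / ((m : ℝ) * ((m : ℝ) - 1)) * R ω - 0‖} ≤ _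
  have hc2 : (√(m : ℝ) / ((m : ℝ) * ((m : ℝ) - 1))) ^ 2
      * (2 * (4 * B) ^ 2 * ((m : ℝ) * ((m : ℝ) - 1))) = 2 * (4 * B) ^ 2 * ((m : ℝ) - 1)⁻¹ := by
    rw [div_pow, Real.sq_sqrt (by linarith)]
    have : (m : ℝ) - 1 ≠ 0 := by linarith
    field_simp
  generalize √(m : ℝ) / ((m : ℝ) * ((m : ℝ) - 1)) = c at *
  clear_value R
  have hRint : Integrable (fun ω => (c * R ω) ^ 2) (Measure.infinitePi fun _ : ℕ => ρ) := by
    refine integrable_of_abs_le ((hRm.const_mul c).pow_const 2)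
      (C := (|c| * ((Finset.univ : Finset (Fin m)).offDiag.card • (4 * B))) ^ 2) fun ω => ?_
    rw [abs_pow, abs_mul]
    exact pow_le_pow_left₀ (by positivity)
      (mul_le_mul_of_nonneg_left (hRb ω) (abs_nonneg c)) 2
  have hcheb := mul_meas_ge_le_integral_of_nonneg (ae_of_all _ fun ω => sq_nonneg (c * R ω)) hRint
    (ε ^ 2)
  have hset : {ω | ε ≤ ‖c * R ω - 0‖} = {ω | ε ^ 2 ≤ (c * R ω) ^ 2} := by
    ext ω
    simp only [Set.mem_ofPred_eq, sub_zero, Real.norm_eq_abs]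
    rw [← sq_abs (c * R ω), pow_le_pow_iff_left₀ hε.le (abs_nonneg _) two_ne_zero]
  have hfin : ∫ ω, (c * R ω) ^ 2 ∂(Measure.infinitePi fun _ : ℕ => ρ)
      ≤ 2 * (4 * B) ^ 2 * ((m : ℝ) - 1)⁻¹ := by
    simp only [mul_pow c]
    rw [integral_const_mul]
    exact (mul_le_mul_of_nonneg_left hmom (sq_nonneg c)).trans_eq hc2
  rw [hset, div_mul_eq_mul_div, le_div_iff₀ (by positivity), mul_comm]
  exact hcheb.trans hfin

/-- **Hoeffding's central limit theorem for U-statistics**, for a bounded symmetric kernel. -/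
theorem tendstoInDistribution_uStat {h : E → E → ℝ} (hh : Measurable fun p : E × E => h p.1 p.2)
    {B : ℝ} (hB : ∀ x y, |h x y| ≤ B) (hsymm : ∀ x y, h x y = h y x) :
    TendstoInDistribution
      (fun (m : ℕ) (ω : ℕ → E) =>
        √(m : ℝ) * (uStat h (fun i : Fin m => ω i) - ∫ p, h p.1 p.2 ∂(ρ.prod ρ)))
      atTop (id : ℝ → ℝ) (fun _ => Measure.infinitePi fun _ : ℕ => ρ)
      (gaussianReal 0 (limitVar ρ h).toNNReal) := by
  refine tendstoInDistribution_of_tendstoInMeasure_sub _ _ (tendstoInDistribution_proj hh hB)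
    ?_ fun m => ?_
  · refine TendstoInMeasure.congr' ?_ (ae_eq_refl _) (tendstoInMeasure_degPart hh hB hsymm)
    filter_upwards [eventually_ge_atTop 2] with m hm
    exact ae_of_all _ fun ω => (uStat_sub_eq ρ hm ω).symm
  · have h1 : Measurable fun ω : ℕ → E => fun i : Fin m => ω i :=
      measurable_pi_lambda _ fun i => measurable_pi_apply _
    have h2 : Measurable fun ω : ℕ → E => uStat h fun i : Fin m => ω i :=
      (measurable_uStat hh).comp h1
    exact ((h2.sub_const _).const_mul _).aemeasurable

/-- The central limit theorem for U-statistics in terms of distribution functions. -/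
theorem tendsto_measureReal_uStat_le {h : E → E → ℝ} (hh : Measurable fun p : E × E => h p.1 p.2)
    {B : ℝ} (hB : ∀ x y, |h x y| ≤ B) (hsymm : ∀ x y, h x y = h y x) {c : ℝ}
    (hc : gaussianReal 0 (limitVar ρ h).toNNReal {c} = 0) :
    Tendsto (fun m : ℕ => (Measure.infinitePi fun _ : ℕ => ρ).real
        {ω | √(m : ℝ) * (uStat h (fun i : Fin m => ω i) - ∫ p, h p.1 p.2 ∂(ρ.prod ρ)) ≤ c})
      atTop (𝓝 ((gaussianReal 0 (limitVar ρ h).toNNReal).real (Set.Iic c))) := by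
  have hd := tendstoInDistribution_uStat (ρ := ρ) hh hB hsymm
  have h1 := ProbabilityMeasure.tendsto_measure_of_null_frontier_of_tendsto' hd.tendsto
    (E := Set.Iic c) (by rw [frontier_Iic]; simpa using hc)
  simp only [ProbabilityMeasure.coe_mk, Measure.map_id] at h1
  have h2 := (ENNReal.tendsto_toReal (measure_ne_top _ _)).comp h1
  refine h2.congr fun m => ?_
  have := hd.forall_aemeasurable m
  simp only [Function.comp_apply]
  rw [Measure.map_apply_of_aemeasurable this measurableSet_Iic]
  rfl

/-- The distribution function of a centred normal law through `Φ`. -/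
theorem gaussianReal_Iic {v : ℝ} (hv : 0 < v) (c : ℝ) :
    (gaussianReal 0 v.toNNReal).real (Set.Iic c) = stdNormalCdf (c / √v) := by
  have hs : 0 < √v := Real.sqrt_pos.2 hv
  have h1 : gaussianReal 0 v.toNNReal = (gaussianReal 0 1).map (√v * ·) := by
    rw [gaussianReal_map_const_mul, mul_zero, mul_one]
    congr 1
    ext
    rw [Real.coe_toNNReal _ hv.le]
    exact (Real.sq_sqrt hv.le).symm
  rw [stdNormalCdf, cdf_eq_real, h1, map_measureReal_apply (by fun_prop) measurableSet_Iic]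
  congr 1
  ext x
  simp [le_div_iff₀ hs, mul_comm]

end clt

/-! ### The kernel, mean embeddings, and the two estimators as U-statistics -/

section kernel

variable {S : Type*} (H : Type*) [NormedAddCommGroup H] [InnerProductSpace ℝ H] [CompleteSpace H]
  [RKHS ℝ H S ℝ]

theorem inner_kerFun_kerFun (x y : S) :
    inner ℝ (RKHS.kerFun H x (1 : ℝ)) (RKHS.kerFun H y (1 : ℝ)) = ker H x y := by
  rw [RKHS.kerFun_inner, RKHS.kerFun_apply, ker]
  simp

theorem ker_symm (x y : S) : ker H x y = ker H y x := by
  rw [← inner_kerFun_kerFun, ← inner_kerFun_kerFun, real_inner_comm]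

/-- The kernel of the U-statistic `mmdSqHat`, on pairs `(x, y)`. -/
def hKer (p q : S × S) : ℝ :=
  ker H p.1 q.1 + ker H p.2 q.2 - ker H p.1 q.2 - ker H p.2 q.1

/-- The kernel of the U-statistic in the denominator of `nammdHat`, on pairs `(x, y)`. -/
def nKer (K : ℝ) (p q : S × S) : ℝ :=
  4 * K - ker H p.1 q.1 - ker H p.2 q.2

/-- The kernel `hKer - c * nKer`; for `c = NAMMD(P, Q)` it is centred. -/
def gKer (K c : ℝ) (p q : S × S) : ℝ :=
  hKer H p q - c * nKer H K p q

/-- A pair of samples as a sample of pairs. -/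
def pairs {S : Type*} {m : ℕ} (Z : Samples S m) (i : Fin m) : S × S := (Z.1 i, Z.2 i)

theorem mmdSqHat_eq_uStat {m : ℕ} (Z : Samples S m) :
    mmdSqHat H Z = uStat (hKer H) (pairs Z) := rfl

theorem nammdHat_eq_uStat (K : ℝ) {m : ℕ} (hm : 2 ≤ m) (Z : Samples S m) :
    nammdHat H K Z = uStat (hKer H) (pairs Z) / uStat (nKer H K) (pairs Z) := by
  have hm' : (2 : ℝ) ≤ m := by exact_mod_cast hm
  have h0 : (m : ℝ) * ((m : ℝ) - 1) ≠ 0 := by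
    have : (0 : ℝ) < (m : ℝ) * ((m : ℝ) - 1) := by nlinarith
    exact this.ne'
  rw [uStat, uStat, div_div_div_cancel_right₀ h0]
  rfl

theorem hKer_symm (p q : S × S) : hKer H p q = hKer H q p := by
  rw [hKer, hKer, ker_symm H p.1 q.1, ker_symm H p.2 q.2, ker_symm H p.1 q.2, ker_symm H p.2 q.1]
  ring

theorem nKer_symm (K : ℝ) (p q : S × S) : nKer H K p q = nKer H K q p := by
  rw [nKer, nKer, ker_symm H p.1 q.1, ker_symm H p.2 q.2]

theorem gKer_symm (K c : ℝ) (p q : S × S) : gKer H K c p q = gKer H K c q p := by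
  rw [gKer, gKer, hKer_symm, nKer_symm]

theorem uStat_nKer_eq (K : ℝ) {m : ℕ} (hm : 2 ≤ m) (Z : Samples S m) :
    uStat (nKer H K) (pairs Z) = 4 * K - uStat (ker H) Z.1 - uStat (ker H) Z.2 := by
  have hm' : (2 : ℝ) ≤ m := by exact_mod_cast hm
  have h0 : (0 : ℝ) < (m : ℝ) * ((m : ℝ) - 1) := by nlinarith
  simp only [uStat, nKer, pairs, Finset.sum_sub_distrib, Finset.sum_const, nsmul_eq_mul,
    card_offDiag_fin, sub_div]
  rw [mul_div_cancel_left₀ _ h0.ne']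

end kernel

theorem uStat_sub_const_mul {E : Type*} {m : ℕ} (f g : E → E → ℝ) (c : ℝ) (X : Fin m → E) :
    uStat (fun x y => f x y - c * g x y) X = uStat f X - c * uStat g X := by
  simp only [uStat, Finset.sum_sub_distrib, ← Finset.mul_sum]
  ring

section means

variable {S : Type*} [MeasurableSpace S] {H : Type*} [NormedAddCommGroup H]
  [InnerProductSpace ℝ H] [CompleteSpace H] [RKHS ℝ H S ℝ] {K : ℝ}

theorem IsBoundedKernel.abs_ker_le (hK : IsBoundedKernel (S := S) H K) (x y : S) :
    |ker H x y| ≤ K := by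
  rw [abs_of_nonneg (hK.nonneg x y)]
  exact hK.le x y

theorem IsBoundedKernel.integral_ker (hK : IsBoundedKernel H K) (P Q : Measure S)
    [IsProbabilityMeasure P] [IsProbabilityMeasure Q] :
    ∫ p, ker H p.1 p.2 ∂(P.prod Q) = inner ℝ (meanEmbedding H P) (meanEmbedding H Q) := by
  rw [integral_prod _ (integrable_of_abs_le hK.measurable fun p => hK.abs_ker_le _ _),
    inner_meanEmbedding hK]
  congr with x
  have h1 := inner_meanEmbedding hK Q (RKHS.kerFun H x (1 : ℝ))
  rw [RKHS.inner_kerFun] at h1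
  simp only [RKHS.kerFun_apply] at h1
  have h2 : meanEmbedding H Q x = ∫ y, ker H y x ∂Q := by simpa [ker] using h1
  rw [h2]
  congr with y
  exact ker_symm H x y

theorem IsBoundedKernel.norm_meanEmbedding_sq_le (hK : IsBoundedKernel H K) (P : Measure S)
    [IsProbabilityMeasure P] : ‖meanEmbedding H P‖ ^ 2 ≤ K := by
  rw [← real_inner_self_eq_norm_sq, ← hK.integral_ker]
  refine (integral_mono (integrable_of_abs_le hK.measurable fun p => hK.abs_ker_le _ _)
    (integrable_const K) fun p => hK.le p.1 p.2).trans_eq ?_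
  simp

theorem IsBoundedKernel.measurable_ker_comp (hK : IsBoundedKernel H K) {Ω : Type*}
    [MeasurableSpace Ω] {f g : Ω → S} (hf : Measurable f) (hg : Measurable g) :
    Measurable fun ω => ker H (f ω) (g ω) :=
  hK.measurable.comp (f := fun ω => (f ω, g ω)) (hf.prodMk hg)

theorem IsBoundedKernel.integrable_ker_comp (hK : IsBoundedKernel H K) {Ω : Type*}
    [MeasurableSpace Ω] {μ : Measure Ω} [IsFiniteMeasure μ] {f g : Ω → S} (hf : Measurable f)
    (hg : Measurable g) : Integrable (fun ω => ker H (f ω) (g ω)) μ :=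
  integrable_of_abs_le (hK.measurable_ker_comp hf hg) fun _ => hK.abs_ker_le _ _

theorem IsBoundedKernel.integral_ker_comp (hK : IsBoundedKernel H K) {E : Type*}
    [MeasurableSpace E] {ρ : Measure E} [IsProbabilityMeasure ρ] {P Q : Measure S}
    [IsProbabilityMeasure P] [IsProbabilityMeasure Q] {f g : E → S} (hf : MeasurePreserving f ρ P)
    (hg : MeasurePreserving g ρ Q) :
    ∫ p : E × E, ker H (f p.1) (g p.2) ∂(ρ.prod ρ)
      = inner ℝ (meanEmbedding H P) (meanEmbedding H Q) := by
  have h := hf.prod hg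
  rw [← hK.integral_ker, ← h.map_eq,
    integral_map h.measurable.aemeasurable hK.measurable.aestronglyMeasurable]
  rfl

theorem IsBoundedKernel.measurable_hKer (hK : IsBoundedKernel (S := S) H K) :
    Measurable fun p : (S × S) × (S × S) => hKer H p.1 p.2 :=
  (((hK.measurable_ker_comp (by fun_prop) (by fun_prop)).add
    (hK.measurable_ker_comp (by fun_prop) (by fun_prop))).sub
    (hK.measurable_ker_comp (by fun_prop) (by fun_prop))).sub
    (hK.measurable_ker_comp (by fun_prop) (by fun_prop))

theorem IsBoundedKernel.measurable_nKer (hK : IsBoundedKernel (S := S) H K) :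
    Measurable fun p : (S × S) × (S × S) => nKer H K p.1 p.2 :=
  (measurable_const.sub (hK.measurable_ker_comp (by fun_prop) (by fun_prop))).sub
    (hK.measurable_ker_comp (by fun_prop) (by fun_prop))

theorem IsBoundedKernel.abs_hKer_le (hK : IsBoundedKernel (S := S) H K) (p q : S × S) :
    |hKer H p q| ≤ 2 * K := by
  have h1 := hK.nonneg; have h2 := hK.le
  rw [hKer, abs_le]
  constructor <;>
    linarith [h1 p.1 q.1, h1 p.2 q.2, h1 p.1 q.2, h1 p.2 q.1, h2 p.1 q.1, h2 p.2 q.2, h2 p.1 q.2,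
      h2 p.2 q.1]

theorem IsBoundedKernel.nKer_mem_Icc (hK : IsBoundedKernel (S := S) H K) (p q : S × S) :
    nKer H K p q ∈ Set.Icc (2 * K) (4 * K) := by
  have h1 := hK.nonneg; have h2 := hK.le
  rw [nKer]
  constructor <;> linarith [h1 p.1 q.1, h1 p.2 q.2, h2 p.1 q.1, h2 p.2 q.2]

theorem IsBoundedKernel.measurable_gKer (hK : IsBoundedKernel (S := S) H K) (c : ℝ) :
    Measurable fun p : (S × S) × (S × S) => gKer H K c p.1 p.2 :=
  hK.measurable_hKer.sub (hK.measurable_nKer.const_mul _)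

theorem IsBoundedKernel.abs_nKer_le (hK : IsBoundedKernel (S := S) H K) (p q : S × S) :
    |nKer H K p q| ≤ 4 * K := by
  have h := hK.nKer_mem_Icc p q
  have h0 : 0 ≤ K := (hK.nonneg p.1 p.1).trans (hK.le _ _)
  exact abs_le.2 ⟨by linarith [h.1], h.2⟩

theorem IsBoundedKernel.abs_gKer_le (hK : IsBoundedKernel (S := S) H K) (c : ℝ) (p q : S × S) :
    |gKer H K c p q| ≤ 2 * K + |c| * (4 * K) :=
  (abs_sub _ _).trans (add_le_add (hK.abs_hKer_le p q)
    (by rw [abs_mul]; exact mul_le_mul_of_nonneg_left (hK.abs_nKer_le p q) (abs_nonneg _)))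

variable (P Q : Measure S) [IsProbabilityMeasure P]
  [IsProbabilityMeasure Q]

theorem IsBoundedKernel.integral_hKer (hK : IsBoundedKernel H K) :
    ∫ p, hKer H p.1 p.2 ∂((P.prod Q).prod (P.prod Q)) = mmdSq H P Q := by
  have f1 : MeasurePreserving (Prod.fst : S × S → S) (P.prod Q) P := measurePreserving_fst
  have f2 : MeasurePreserving (Prod.snd : S × S → S) (P.prod Q) Q := measurePreserving_snd
  have hi : ∀ {f g : (S × S) × (S × S) → S}, Measurable f → Measurable g →
      Integrable (fun ω => ker H (f ω) (g ω)) ((P.prod Q).prod (P.prod Q)) := fun hf hg =>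
    hK.integrable_ker_comp hf hg
  simp only [hKer]
  rw [integral_sub (f := fun p : (S × S) × (S × S) =>
        ker H p.1.1 p.2.1 + ker H p.1.2 p.2.2 - ker H p.1.1 p.2.2)
      (((hi (by fun_prop) (by fun_prop)).add (hi (by fun_prop) (by fun_prop))).sub
        (hi (by fun_prop) (by fun_prop))) (hi (by fun_prop) (by fun_prop)),
    integral_sub (f := fun p : (S × S) × (S × S) => ker H p.1.1 p.2.1 + ker H p.1.2 p.2.2)
      ((hi (by fun_prop) (by fun_prop)).add (hi (by fun_prop) (by fun_prop)))
      (hi (by fun_prop) (by fun_prop)),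
    integral_add (hi (by fun_prop) (by fun_prop)) (hi (by fun_prop) (by fun_prop)),
    hK.integral_ker_comp f1 f1, hK.integral_ker_comp f2 f2, hK.integral_ker_comp f1 f2,
    hK.integral_ker_comp f2 f1, mmdSq, norm_sub_sq_real, real_inner_self_eq_norm_sq,
    real_inner_self_eq_norm_sq, real_inner_comm (meanEmbedding H P) (meanEmbedding H Q)]
  ring

theorem IsBoundedKernel.integral_nKer (hK : IsBoundedKernel H K) :
    ∫ p, nKer H K p.1 p.2 ∂((P.prod Q).prod (P.prod Q)) = normTerm H K P Q := by
  have f1 : MeasurePreserving (Prod.fst : S × S → S) (P.prod Q) P := measurePreserving_fst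
  have f2 : MeasurePreserving (Prod.snd : S × S → S) (P.prod Q) Q := measurePreserving_snd
  have hi : ∀ {f g : (S × S) × (S × S) → S}, Measurable f → Measurable g →
      Integrable (fun ω => ker H (f ω) (g ω)) ((P.prod Q).prod (P.prod Q)) := fun hf hg =>
    hK.integrable_ker_comp hf hg
  simp only [nKer]
  rw [integral_sub (f := fun p : (S × S) × (S × S) => 4 * K - ker H p.1.1 p.2.1)
      ((integrable_const _).sub (hi (by fun_prop) (by fun_prop)))
      (hi (by fun_prop) (by fun_prop)),
    integral_sub (integrable_const _) (hi (by fun_prop) (by fun_prop)),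
    hK.integral_ker_comp f1 f1, hK.integral_ker_comp f2 f2, normTerm, real_inner_self_eq_norm_sq,
    real_inner_self_eq_norm_sq]
  simp

/-- The first `m` terms of a sequence of pairs, as a pair of samples. -/
def sampleMap (S : Type*) (m : ℕ) (ω : ℕ → S × S) : Samples S m :=
  (fun i => (ω i).1, fun i => (ω i).2)

theorem measurePreserving_sampleMap (m : ℕ) :
    MeasurePreserving (sampleMap S m) (Measure.infinitePi fun _ : ℕ => P.prod Q)
      (samplesLaw P Q m) := by
  have h1 : MeasurePreserving (fun (ω : ℕ → S × S) (i : Fin m) => ω i)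
      (Measure.infinitePi fun _ : ℕ => P.prod Q) (Measure.pi fun _ : Fin m => P.prod Q) := by
    refine ⟨measurable_pi_lambda _ fun i => measurable_pi_apply _, ?_⟩
    rw [Measure.map_infinitePi_infinitePi_of_inj (P := fun _ : ℕ => P.prod Q) Fin.val_injective,
      Measure.infinitePi_eq_pi]
  exact (measurePreserving_arrowProdEquivProdArrow S S (Fin m) (fun _ => P) (fun _ => Q)).comp h1

instance (m : ℕ) : IsProbabilityMeasure (samplesLaw P Q m) := by
  unfold samplesLaw; infer_instance

/-- Passing from samples to sequences can only lower the probability of a set, measurable or not. -/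
theorem measureReal_sampleMap_preimage_le {m : ℕ} (s : Set (Samples S m)) :
    (Measure.infinitePi fun _ : ℕ => P.prod Q).real (sampleMap S m ⁻¹' s)
      ≤ (samplesLaw P Q m).real s := by
  have h := measurePreserving_sampleMap P Q m
  refine ENNReal.toReal_mono (measure_ne_top _ _) ?_
  rw [← h.map_eq]
  exact Measure.le_map_apply h.measurable.aemeasurable s

/-- The moments of three independent pairs give four times the variance of the Hájek projection. -/
theorem sqrt_moments_eq_sqrt_limitVar {g : S × S → S × S → ℝ}
    (hg : Measurable fun p : (S × S) × (S × S) => g p.1 p.2) {B : ℝ} (hB : ∀ x y, |g x y| ≤ B) :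
    √(4 * (∫ Z : Samples S 3, g (pairs Z 0) (pairs Z 1) * g (pairs Z 0) (pairs Z 2)
        ∂samplesLaw P Q 3) - 4 * (∫ Z : Samples S 3, g (pairs Z 0) (pairs Z 1)
        ∂samplesLaw P Q 3) ^ 2) = √(limitVar (P.prod Q) g) := by
  have h := measurePreserving_sampleMap P Q 3
  have hp : ∀ i : Fin 3, Measurable fun Z : Samples S 3 => pairs Z i := fun i => by
    unfold pairs; fun_prop
  have hm : ∀ i j : Fin 3, Measurable fun Z : Samples S 3 => g (pairs Z i) (pairs Z j) :=
    fun i j => hg.comp ((hp i).prodMk (hp j))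
  rw [limitVar, ← integral_mul_eval_shared hg hB, ← integral_eval_pair hg (zero_ne_one),
    ← h.map_eq, integral_map h.measurable.aemeasurable
      (f := fun Z : Samples S 3 => g (pairs Z 0) (pairs Z 1) * g (pairs Z 0) (pairs Z 2))
      ((hm 0 1).mul (hm 0 2)).aestronglyMeasurable,
    integral_map h.measurable.aemeasurable (hm 0 1).aestronglyMeasurable, mul_sub]
  rfl

theorem sigmaM_eq (hK : IsBoundedKernel H K) : sigmaM H P Q = √(limitVar (P.prod Q) (hKer H)) :=
  sqrt_moments_eq_sqrt_limitVar P Q hK.measurable_hKer hK.abs_hKer_le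

theorem sigmaStar_eq (hK : IsBoundedKernel H K) : sigmaStar H K P Q = √(limitVar (P.prod Q) (gKer H K (nammd H K P Q))) :=
  sqrt_moments_eq_sqrt_limitVar P Q (hK.measurable_gKer _) (hK.abs_gKer_le _)

theorem IsBoundedKernel.two_mul_le_normTerm (hK : IsBoundedKernel H K) : 2 * K ≤ normTerm H K P Q := by
  have h1 := hK.norm_meanEmbedding_sq_le P
  have h2 := hK.norm_meanEmbedding_sq_le Q
  rw [normTerm]; linarith

theorem IsBoundedKernel.integral_gKer (hK : IsBoundedKernel H K) (hK0 : 0 < K) :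
    ∫ p, gKer H K (nammd H K P Q) p.1 p.2 ∂((P.prod Q).prod (P.prod Q)) = 0 := by
  have hN := hK.two_mul_le_normTerm P Q
  simp only [gKer]
  rw [integral_sub (integrable_of_abs_le hK.measurable_hKer fun p => hK.abs_hKer_le _ _)
      ((integrable_of_abs_le hK.measurable_nKer fun p => hK.abs_nKer_le _ _).const_mul _),
    integral_const_mul, hK.integral_hKer P Q, hK.integral_nKer P Q, nammd,
    div_mul_cancel₀ _ (by linarith : normTerm H K P Q ≠ 0), sub_self]

end means

/-! ### Concentration of the denominator -/

theorem uStat_mem_Icc {E : Type*} {m : ℕ} (hm : 2 ≤ m) {f : E → E → ℝ} {a b : ℝ}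
    (hf : ∀ x y, f x y ∈ Set.Icc a b) (X : Fin m → E) : uStat f X ∈ Set.Icc a b := by
  have hm' : (2 : ℝ) ≤ m := by exact_mod_cast hm
  have h0 : (0 : ℝ) < (m : ℝ) * ((m : ℝ) - 1) := by nlinarith
  rw [uStat, Set.mem_Icc, le_div_iff₀ h0, div_le_iff₀ h0, ← card_offDiag_fin, mul_comm a,
    mul_comm b, ← nsmul_eq_mul, ← nsmul_eq_mul]
  exact ⟨Finset.card_nsmul_le_sum _ _ _ fun p _ => (hf _ _).1,
    Finset.sum_le_card_nsmul _ _ _ fun p _ => (hf _ _).2⟩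

section denominator

variable {S : Type*} [MeasurableSpace S] {H : Type*} [NormedAddCommGroup H]
  [InnerProductSpace ℝ H] [CompleteSpace H] [RKHS ℝ H S ℝ] {K : ℝ}

/-- The two samples enter the denominator through independent U-statistics, each with a kernel of
range `K` (and not `2 * K`); this is what saves the constant for odd sample sizes. -/
theorem IsBoundedKernel.hasSubgaussianMGF_denominator (hK : IsBoundedKernel (S := S) H K)
    (P Q : Measure S) [IsProbabilityMeasure P] [IsProbabilityMeasure Q] {m : ℕ} (hm : 2 ≤ m) :
    HasSubgaussianMGF
      (fun Z : Samples S m => normTerm H K P Q - uStat (nKer H K) (pairs Z))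
      ((‖K‖₊ / 2) ^ 2 / (m / 2 : ℕ) + (‖K‖₊ / 2) ^ 2 / (m / 2 : ℕ)) (samplesLaw P Q m) := by
  have hP := hasSubgaussianMGF_uStat P hK.measurable (a := 0) (b := K)
    (fun x y => ⟨hK.nonneg x y, hK.le x y⟩) hm
  have hQ := hasSubgaussianMGF_uStat Q hK.measurable (a := 0) (b := K)
    (fun x y => ⟨hK.nonneg x y, hK.le x y⟩) hm
  have hmeas := measurable_uStat (m := m) hK.measurable
  rw [sub_zero] at hP hQ
  have hP' : HasSubgaussianMGF
      (fun Z : Samples S m => uStat (ker H) Z.1 - ∫ p, ker H p.1 p.2 ∂(P.prod P))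
      ((‖K‖₊ / 2) ^ 2 / (m / 2 : ℕ)) (samplesLaw P Q m) := by
    refine HasSubgaussianMGF.of_map (Y := Prod.fst)
      (X := fun X => uStat (ker H) X - ∫ p, ker H p.1 p.2 ∂(P.prod P))
      measurable_fst.aemeasurable ?_
    rw [samplesLaw, measurePreserving_fst.map_eq]
    exact hP
  have hQ' : HasSubgaussianMGF
      (fun Z : Samples S m => uStat (ker H) Z.2 - ∫ p, ker H p.1 p.2 ∂(Q.prod Q))
      ((‖K‖₊ / 2) ^ 2 / (m / 2 : ℕ)) (samplesLaw P Q m) := by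
    refine HasSubgaussianMGF.of_map (Y := Prod.snd)
      (X := fun X => uStat (ker H) X - ∫ p, ker H p.1 p.2 ∂(Q.prod Q))
      measurable_snd.aemeasurable ?_
    rw [samplesLaw, measurePreserving_snd.map_eq]
    exact hQ
  have hsum := hP'.add_of_indepFun hQ'
    (indepFun_prod (hmeas.sub_const _) (hmeas.sub_const _))
  refine hsum.congr (ae_of_all _ fun Z => ?_)
  simp only [uStat_nKer_eq H K hm, hK.integral_ker, real_inner_self_eq_norm_sq, normTerm]
  ring

theorem measureReal_ge_le_exp {Ω : Type*} [MeasurableSpace Ω] {μ : Measure Ω} {X : Ω → ℝ} {m : ℕ}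
    (hm : 2 ≤ m) (hK : 0 < K)
    (hX : HasSubgaussianMGF X ((‖K‖₊ / 2) ^ 2 / (m / 2 : ℕ) + (‖K‖₊ / 2) ^ 2 / (m / 2 : ℕ)) μ)
    {t : ℝ} (ht : 0 ≤ t) :
    μ.real {ω | t ≤ X ω} ≤ Real.exp (-((m : ℝ) * t ^ 2 / (4 * K ^ 2))) := by
  refine (hX.measure_ge_le ht).trans (Real.exp_le_exp.2 ?_)
  have hn : (m : ℝ) ≤ 4 * ((m / 2 : ℕ) : ℝ) := by
    have : m ≤ 4 * (m / 2) := by omega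
    exact_mod_cast this
  have hm' : (2 : ℝ) ≤ m := by exact_mod_cast hm
  push_cast
  rw [Real.norm_of_nonneg hK.le]
  generalize ((m / 2 : ℕ) : ℝ) = n at hn ⊢
  have hn0 : 0 < n := by linarith
  rw [show -t ^ 2 / (2 * ((K / 2) ^ 2 / n + (K / 2) ^ 2 / n)) = -(4 * n * t ^ 2 / (4 * K ^ 2)) by
    field_simp; ring]
  gcongr

theorem IsBoundedKernel.measureReal_denominator_ge (hK : IsBoundedKernel (S := S) H K)
    (hK0 : 0 < K) (P Q : Measure S) [IsProbabilityMeasure P] [IsProbabilityMeasure Q] {m : ℕ}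
    (hm : 2 ≤ m) {t : ℝ} (ht : 0 ≤ t) :
    (samplesLaw P Q m).real {Z | t ≤ uStat (nKer H K) (pairs Z) - normTerm H K P Q}
      ≤ Real.exp (-((m : ℝ) * t ^ 2 / (4 * K ^ 2))) := by
  have h := (hK.hasSubgaussianMGF_denominator P Q hm).neg
  have h' := measureReal_ge_le_exp hm hK0 h ht
  simpa using h'

theorem IsBoundedKernel.measureReal_denominator_le (hK : IsBoundedKernel (S := S) H K)
    (hK0 : 0 < K) (P Q : Measure S) [IsProbabilityMeasure P] [IsProbabilityMeasure Q] {m : ℕ}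
    (hm : 2 ≤ m) {t : ℝ} (ht : 0 ≤ t) :
    (samplesLaw P Q m).real {Z | t ≤ normTerm H K P Q - uStat (nKer H K) (pairs Z)}
      ≤ Real.exp (-((m : ℝ) * t ^ 2 / (4 * K ^ 2))) :=
  measureReal_ge_le_exp hm hK0 (hK.hasSubgaussianMGF_denominator P Q hm) ht

end denominator

/-! ### The MMD test rejecting forces the NAMMD test to reject -/

section implication

variable {S : Type*} [MeasurableSpace S] {H : Type*} [NormedAddCommGroup H]
  [InnerProductSpace ℝ H] [CompleteSpace H] [RKHS ℝ H S ℝ] {K : ℝ} {P₁ Q₁ P₂ Q₂ : Measure S}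

theorem gapDelta_eq (α : ℝ) (m : ℕ) :
    gapDelta H K P₁ Q₁ P₂ Q₂ α m = √(m : ℝ) * nammd H K P₁ Q₁ *
      ((normTerm H K P₁ Q₁ - normTerm H K P₂ Q₂) / tauM H P₁ Q₁ P₂ Q₂ α m) := by
  rw [gapDelta, tauM, normTerm, normTerm]
  congr 2
  ring

/-- The reason for the definition of `Δ`: the two thresholds differ by the factor `(1 - Δ) / N₂`. -/
theorem tauN_eq_tauM_mul {α : ℝ} {m : ℕ} (h1 : normTerm H K P₁ Q₁ ≠ 0)
    (h2 : normTerm H K P₂ Q₂ ≠ 0) (hτ : tauM H P₁ Q₁ P₂ Q₂ α m ≠ 0) :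
    tauN H K P₁ Q₁ P₂ Q₂ α m
      = tauM H P₁ Q₁ P₂ Q₂ α m * (1 - gapDelta H K P₁ Q₁ P₂ Q₂ α m) / normTerm H K P₂ Q₂ := by
  have e : tauM H P₁ Q₁ P₂ Q₂ α m * (1 - gapDelta H K P₁ Q₁ P₂ Q₂ α m)
      = tauM H P₁ Q₁ P₂ Q₂ α m
        - √(m : ℝ) * nammd H K P₁ Q₁ * (normTerm H K P₁ Q₁ - normTerm H K P₂ Q₂) := by
    rw [gapDelta_eq]; field_simp
  rw [e, tauN, tauM, nammd]
  field_simp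
  ring

theorem gapDelta_mem_Ioo {α : ℝ} {m : ℕ} (hα : α ≤ 1 / 2) (hm : 2 ≤ m)
    (hε : 0 < nammd H K P₁ Q₁) (hN2 : 2 * K ≤ normTerm H K P₂ Q₂) (hN2' : 0 < normTerm H K P₂ Q₂)
    (hN : normTerm H K P₂ Q₂ < normTerm H K P₁ Q₁) :
    gapDelta H K P₁ Q₁ P₂ Q₂ α m ∈ Set.Ioo (0 : ℝ) (1 / 2) := by
  have hm' : (2 : ℝ) ≤ m := by exact_mod_cast hm
  have hs : 0 < √(m : ℝ) := Real.sqrt_pos.2 (by linarith)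
  have hN1 : 0 < normTerm H K P₁ Q₁ := hN2'.trans hN
  have hM : 0 < mmdSq H P₁ Q₁ := by
    rw [nammd, div_pos_iff_of_pos_right hN1] at hε; exact hε
  -- the mean embeddings of the reference pair differ, so they do not both vanish
  have hN1' : normTerm H K P₁ Q₁ < 4 * K := by
    rw [mmdSq] at hM
    by_contra! hcon
    rw [normTerm] at hcon
    have e1 : ‖meanEmbedding H P₁‖ ^ 2 = 0 := by
      linarith [sq_nonneg ‖meanEmbedding H P₁‖, sq_nonneg ‖meanEmbedding H Q₁‖]
    have e2 : ‖meanEmbedding H Q₁‖ ^ 2 = 0 := by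
      linarith [sq_nonneg ‖meanEmbedding H P₁‖, sq_nonneg ‖meanEmbedding H Q₁‖]
    rw [sq_eq_zero_iff, norm_eq_zero] at e1 e2
    simp [e1, e2] at hM
  have hτ : √(m : ℝ) * mmdSq H P₁ Q₁ ≤ tauM H P₁ Q₁ P₂ Q₂ α m :=
    le_add_of_nonneg_right (mul_nonneg (Real.sqrt_nonneg _) (normalQuantile_nonneg hα))
  have hτ0 : 0 < √(m : ℝ) * mmdSq H P₁ Q₁ := mul_pos hs hM
  rw [gapDelta_eq]
  have hd : 0 < normTerm H K P₁ Q₁ - normTerm H K P₂ Q₂ := by linarith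
  refine ⟨mul_pos (mul_pos hs hε) (div_pos hd (hτ0.trans_le hτ)), ?_⟩
  calc √(m : ℝ) * nammd H K P₁ Q₁ * ((normTerm H K P₁ Q₁ - normTerm H K P₂ Q₂)
        / tauM H P₁ Q₁ P₂ Q₂ α m)
      ≤ √(m : ℝ) * nammd H K P₁ Q₁ * ((normTerm H K P₁ Q₁ - normTerm H K P₂ Q₂)
        / (√(m : ℝ) * mmdSq H P₁ Q₁)) := by gcongr
    _ = (normTerm H K P₁ Q₁ - normTerm H K P₂ Q₂) / normTerm H K P₁ Q₁ := by
        rw [nammd]; field_simp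
    _ < 1 / 2 := by rw [div_lt_iff₀ hN1]; linarith

theorem IsBoundedKernel.measureReal_imp_ge (hK : IsBoundedKernel (S := S) H K) (hK0 : 0 < K)
    [IsProbabilityMeasure P₁] [IsProbabilityMeasure Q₁] [IsProbabilityMeasure P₂]
    [IsProbabilityMeasure Q₂] {α : ℝ} {m : ℕ} (hm : 2 ≤ m) (hε : 0 < nammd H K P₁ Q₁)
    (hN : normTerm H K P₂ Q₂ < normTerm H K P₁ Q₁)
    (hΔ : gapDelta H K P₁ Q₁ P₂ Q₂ α m ∈ Set.Ioo (0 : ℝ) (1 / 2)) :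
    1 - Real.exp (-((m : ℝ) * gapDelta H K P₁ Q₁ P₂ Q₂ α m ^ 2 * normTerm H K P₂ Q₂ ^ 2
          / (4 * K ^ 2 * (1 - gapDelta H K P₁ Q₁ P₂ Q₂ α m) ^ 2)))
      ≤ (samplesLaw P₂ Q₂ m).real
        {Z | MMDRejects H P₁ Q₁ P₂ Q₂ α Z → NAMMDRejects H K P₁ Q₁ P₂ Q₂ α Z} := by
  have hm' : (2 : ℝ) ≤ m := by exact_mod_cast hm
  have hs : 0 < √(m : ℝ) := Real.sqrt_pos.2 (by linarith)
  have hN2 : 0 < normTerm H K P₂ Q₂ := by linarith [hK.two_mul_le_normTerm P₂ Q₂]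
  have hN1 : 0 < normTerm H K P₁ Q₁ := hN2.trans hN
  have hτ : 0 < tauM H P₁ Q₁ P₂ Q₂ α m := by
    have h := hΔ.1
    rw [gapDelta_eq, mul_pos_iff_of_pos_left (mul_pos hs hε),
      div_pos_iff_of_pos_left (by linarith)] at h
    exact h
  have hτN := tauN_eq_tauM_mul (K := K) hN1.ne' hN2.ne' hτ.ne'
  set Δ := gapDelta H K P₁ Q₁ P₂ Q₂ α m
  have hΔ1 : 0 < 1 - Δ := by linarith [hΔ.2]
  set t := normTerm H K P₂ Q₂ * Δ / (1 - Δ) with ht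
  have ht0 : 0 ≤ t := div_nonneg (mul_nonneg hN2.le hΔ.1.le) hΔ1.le
  have hbad := hK.measureReal_denominator_ge hK0 P₂ Q₂ hm ht0
  have hexp : (m : ℝ) * t ^ 2 / (4 * K ^ 2)
      = (m : ℝ) * Δ ^ 2 * normTerm H K P₂ Q₂ ^ 2 / (4 * K ^ 2 * (1 - Δ) ^ 2) := by
    rw [ht]; field_simp
  rw [hexp] at hbad
  have hcover : (Set.univ : Set (Samples S m)) ⊆
      {Z | MMDRejects H P₁ Q₁ P₂ Q₂ α Z → NAMMDRejects H K P₁ Q₁ P₂ Q₂ α Z}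
        ∪ {Z | t ≤ uStat (nKer H K) (pairs Z) - normTerm H K P₂ Q₂} := by
    intro Z _
    by_cases hZ : t ≤ uStat (nKer H K) (pairs Z) - normTerm H K P₂ Q₂
    · exact Or.inr hZ
    refine Or.inl fun hrej => ?_
    have hrej' : tauM H P₁ Q₁ P₂ Q₂ α m < √(m : ℝ) * mmdSqHat H Z := hrej
    have hpos : 0 < uStat (nKer H K) (pairs Z) := by
      linarith [(uStat_mem_Icc hm hK.nKer_mem_Icc (pairs Z)).1]
    have hlt : uStat (nKer H K) (pairs Z) * (1 - Δ) < normTerm H K P₂ Q₂ := by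
      have h1 : uStat (nKer H K) (pairs Z) < normTerm H K P₂ Q₂ + t := by linarith
      have h2 : (normTerm H K P₂ Q₂ + t) * (1 - Δ) = normTerm H K P₂ Q₂ := by
        rw [ht]; field_simp; ring
      rw [← h2]
      exact mul_lt_mul_of_pos_right h1 hΔ1
    change tauN H K P₁ Q₁ P₂ Q₂ α m < √(m : ℝ) * nammdHat H K Z
    rw [hτN, nammdHat_eq_uStat H K hm, ← mmdSqHat_eq_uStat, ← mul_div_assoc,
      div_lt_div_iff₀ hN2 hpos]
    calc tauM H P₁ Q₁ P₂ Q₂ α m * (1 - Δ) * uStat (nKer H K) (pairs Z)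
        = tauM H P₁ Q₁ P₂ Q₂ α m * (uStat (nKer H K) (pairs Z) * (1 - Δ)) := by ring
      _ < tauM H P₁ Q₁ P₂ Q₂ α m * normTerm H K P₂ Q₂ := mul_lt_mul_of_pos_left hlt hτ
      _ < √(m : ℝ) * mmdSqHat H Z * normTerm H K P₂ Q₂ := mul_lt_mul_of_pos_right hrej' hN2
  have h1 := (measureReal_mono hcover (μ := samplesLaw P₂ Q₂ m)).trans (measureReal_union_le _ _)
  rw [probReal_univ] at h1
  linarith

end implication

/-! ### The window of sample sizes -/

/-- For `m` in the window, the normalised distance `a` of the MMD from the threshold lies in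
`[0, 0.7]`, and the NAMMD gains the amount `l = √m (1 - N₂/N₁) M₁` (`r = N₂/N₁`) on it. -/
theorem window_bounds {z σ M₁ M₂ r c n : ℝ} (hn : 0 < n) (hσ : 0 ≤ σ) (hM : M₁ < M₂)
    (hr : r < 1) (hM₁ : 0 < M₁) (hc : 0 ≤ c)
    (hlow : max ((z * σ / (M₂ - M₁)) ^ 2) ((c / ((1 - r) * M₁)) ^ 2) ≤ n)
    (hup : n ≤ ((z + 0.7) * σ / (M₂ - M₁)) ^ 2) :
    0 < σ ∧ 0 ≤ √n * (M₂ - M₁) / σ - z ∧ √n * (M₂ - M₁) / σ - z ≤ 0.7 ∧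
      c ≤ √n * ((1 - r) * M₁) := by
  have hσ0 : 0 < σ := by
    rcases hσ.eq_or_lt with h | h
    · rw [← h] at hup
      norm_num at hup
      linarith
    · exact h
  have hD : 0 < M₂ - M₁ := by linarith
  have hL : 0 < (1 - r) * M₁ := mul_pos (by linarith) hM₁
  have h1 := Real.abs_le_sqrt ((le_max_left _ _).trans hlow)
  have h2 := Real.abs_le_sqrt ((le_max_right _ _).trans hlow)
  have h3 := Real.sqrt_le_left (x := n) (y := |(z + 0.7) * σ / (M₂ - M₁)|) (abs_nonneg _)
  rw [sq_abs] at h3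
  have h3 := h3.2 hup
  rw [abs_div, abs_mul, abs_of_pos hD, abs_of_pos hσ0, div_le_iff₀ hD] at h1
  rw [abs_of_nonneg (div_nonneg hc hL.le), div_le_iff₀ hL] at h2
  rw [abs_div, abs_mul, abs_of_pos hD, abs_of_pos hσ0, le_div_iff₀ hD] at h3
  have h1' : |z| ≤ √n * (M₂ - M₁) / σ := (le_div_iff₀ hσ0).2 h1
  have h3' : √n * (M₂ - M₁) / σ ≤ |z + 0.7| := (div_le_iff₀ hσ0).2 h3
  refine ⟨hσ0, by linarith [le_abs_self z], ?_, h2⟩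
  -- if `z + 0.7` were negative, the two bounds would read `-z ≤ -z - 0.7`
  rcases abs_cases (z + 0.7) with ⟨h, _⟩ | ⟨h, _⟩
  · linarith
  · linarith [neg_abs_le z]

section power

variable {S : Type*} [MeasurableSpace S] {H : Type*} [NormedAddCommGroup H]
  [InnerProductSpace ℝ H] [CompleteSpace H] [RKHS ℝ H S ℝ] {K : ℝ} {P₁ Q₁ P₂ Q₂ : Measure S}

theorem one_div_le_normalPowerN_sub {α a : ℝ} {m : ℕ}
    (hN1 : 0 < normTerm H K P₁ Q₁) (hN2 : 0 < normTerm H K P₂ Q₂) (hσ : 0 < sigmaM H P₂ Q₂)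
    (ha : a = √(m : ℝ) * (mmdSq H P₂ Q₂ - mmdSq H P₁ Q₁) / sigmaM H P₂ Q₂ - normalQuantile α)
    (ha0 : 0 ≤ a) (ha1 : a ≤ 0.7)
    (hl : 0.051 * sigmaM H P₂ Q₂ ≤ √(m : ℝ) *
      ((1 - normTerm H K P₂ Q₂ / normTerm H K P₁ Q₁) * mmdSq H P₁ Q₁)) :
    1 / 65 ≤ normalPowerN H K P₁ Q₁ P₂ Q₂ α m - normalPowerM H P₁ Q₁ P₂ Q₂ α m := by
  have eM : (√(m : ℝ) * mmdSq H P₂ Q₂ - tauM H P₁ Q₁ P₂ Q₂ α m) / sigmaM H P₂ Q₂ = a := by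
    rw [ha, tauM]; field_simp; ring
  have eN : (√(m : ℝ) * nammd H K P₂ Q₂ - tauN H K P₁ Q₁ P₂ Q₂ α m)
      / (sigmaM H P₂ Q₂ / normTerm H K P₂ Q₂) = a + √(m : ℝ) *
        ((1 - normTerm H K P₂ Q₂ / normTerm H K P₁ Q₁) * mmdSq H P₁ Q₁) / sigmaM H P₂ Q₂ := by
    rw [ha, tauN, nammd, nammd]; field_simp; ring
  rw [normalPowerN, normalPowerM, eM, eN]
  have h1 : (0.051 : ℝ) ≤ √(m : ℝ) *
      ((1 - normTerm H K P₂ Q₂ / normTerm H K P₁ Q₁) * mmdSq H P₁ Q₁) / sigmaM H P₂ Q₂ :=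
    (le_div_iff₀ hσ).2 hl
  have h2 := stdNormalCdf_mono (add_le_add_right h1 a)
  linarith [one_div_lt_stdNormalCdf_sub ha0 ha1]

end power

/-! ### Uniformity of the limit over the window -/

/-- Pointwise convergence of the monotone functions `F m` and `G m` to continuous limits gives a
lower bound for `F m - G m` that is uniform over the compact parameter interval `[0, 0.7]`, with
some room `δ` in the argument of `G m`. -/
theorem eventually_forall_one_div_le {F G D : ℕ → ℝ → ℝ} {φ ψ c : ℝ → ℝ} {σ : ℝ} (hσ : 0 ≤ σ)
    (hF : ∀ m, Monotone (F m)) (hG : ∀ m, Monotone (G m)) (hφ : Continuous φ) (hψ : Continuous ψ)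
    (hc : Continuous c) (hcm : Monotone c) (hcpos : ∀ a, -0.05 < a → 0 < c a)
    (hFlim : ∀ x, Tendsto (fun m => F m (x * σ)) atTop (𝓝 (φ x)))
    (hGlim : ∀ x, x < 0 → Tendsto (fun m => G m x) atTop (𝓝 (ψ x)))
    (hDlim : ∀ δ, 0 < δ → Tendsto (fun m => D m δ) atTop (𝓝 0))
    (hgap : ∀ a, 0 ≤ a → a ≤ 0.7 → 1 / 65 < φ (-a) - ψ (-c a)) :
    ∀ᶠ m in atTop, ∀ a ∈ Set.Icc (0 : ℝ) 0.7, ∃ δ, 0 < δ ∧ δ < 1 ∧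
      1 / 65 ≤ F m (-a * σ) - G m (-((1 - δ) * c a)) - D m δ := by
  refine isCompact_Icc.induction_on (p := fun s => ∀ᶠ m in atTop, ∀ a ∈ s, ∃ δ, 0 < δ ∧ δ < 1 ∧
    1 / 65 ≤ F m (-a * σ) - G m (-((1 - δ) * c a)) - D m δ) (by simp)
    (fun s t hst h => h.mono fun m hm a ha => hm a (hst ha))
    (fun s t hs ht => (hs.and ht).mono fun m hm a ha => ha.elim (hm.1 a) (hm.2 a)) fun a₀ ha₀ => ?_
  have hu : Continuous fun t => φ (-(a₀ + t)) - ψ (-((1 - t) * c (a₀ - t))) := by fun_prop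
  have hev : ∀ᶠ t in 𝓝[>] (0 : ℝ), 1 / 65 < φ (-(a₀ + t)) - ψ (-((1 - t) * c (a₀ - t))) := by
    refine (hu.tendsto 0).mono_left nhdsWithin_le_nhds |>.eventually_const_lt ?_
    simpa using hgap a₀ ha₀.1 ha₀.2
  obtain ⟨t, ht, ht0⟩ := (hev.and (Ioo_mem_nhdsGT (show (0 : ℝ) < 0.05 by norm_num))).exists
  have hct : 0 < c (a₀ - t) := hcpos _ (by linarith [ha₀.1, ht0.2])
  have ht1 : t < 1 := ht0.2.trans (by norm_num)
  have hneg : -((1 - t) * c (a₀ - t)) < 0 := by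
    have := mul_pos (show 0 < 1 - t by linarith) hct
    linarith
  have hlim := ((hFlim (-(a₀ + t))).sub (hGlim _ hneg)).sub (hDlim t ht0.1)
  rw [sub_zero] at hlim
  refine ⟨Set.Ioo (a₀ - t) (a₀ + t), mem_nhdsWithin_of_mem_nhds
    (Ioo_mem_nhds (by linarith [ht0.1]) (by linarith [ht0.1])), ?_⟩
  filter_upwards [hlim.eventually_const_lt ht] with m hm a ha
  refine ⟨t, ht0.1, ht1, ?_⟩
  have h1 : F m (-(a₀ + t) * σ) ≤ F m (-a * σ) :=
    hF m (mul_le_mul_of_nonneg_right (by linarith [ha.2]) hσ)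
  have h2 : G m (-((1 - t) * c a)) ≤ G m (-((1 - t) * c (a₀ - t))) :=
    hG m (neg_le_neg (mul_le_mul_of_nonneg_left (hcm ha.1.le) (by linarith)))
  linarith

/-! ### The NAMMD test rejecting while the MMD test does not -/

section disagree

variable {S : Type*} [MeasurableSpace S] {H : Type*} [NormedAddCommGroup H]
  [InnerProductSpace ℝ H] [CompleteSpace H] [RKHS ℝ H S ℝ] {K : ℝ} (P Q : Measure S)
  [IsProbabilityMeasure P] [IsProbabilityMeasure Q]

theorem IsBoundedKernel.tendsto_measureReal_denominator_le (hK : IsBoundedKernel (S := S) H K)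
    (hK0 : 0 < K) {t : ℝ} (ht : 0 < t) :
    Tendsto (fun m : ℕ => (samplesLaw P Q m).real
      {Z | t ≤ normTerm H K P Q - uStat (nKer H K) (pairs Z)}) atTop (𝓝 0) := by
  have hlim : Tendsto (fun m : ℕ => Real.exp (-((m : ℝ) * t ^ 2 / (4 * K ^ 2)))) atTop (𝓝 0) := by
    refine Real.tendsto_exp_neg_atTop_nhds_zero.comp ?_
    have h := tendsto_natCast_atTop_atTop (R := ℝ).atTop_mul_const
      (show 0 < t ^ 2 / (4 * K ^ 2) by positivity)
    exact h.congr fun m => by rw [mul_div_assoc]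
  refine tendsto_of_tendsto_of_tendsto_of_le_of_le' tendsto_const_nhds hlim
    (Eventually.of_forall fun m => measureReal_nonneg) ?_
  filter_upwards [eventually_ge_atTop 2] with m hm
  exact hK.measureReal_denominator_le hK0 P Q hm ht.le

/-- The law of an i.i.d. sequence of pairs `(x_i, y_i)` with independent entries `x_i ∼ P`,
`y_i ∼ Q`. -/
def seqLaw (P Q : Measure S) : Measure (ℕ → S × S) := Measure.infinitePi fun _ => P.prod Q

instance : IsProbabilityMeasure (seqLaw P Q) := by unfold seqLaw; infer_instance

theorem IsBoundedKernel.tendsto_mmd_cdf (hK : IsBoundedKernel (S := S) H K)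
    (hσ : 0 < sigmaM H P Q) (x : ℝ) :
    Tendsto (fun m : ℕ => (seqLaw P Q).real
      {ω | √(m : ℝ) * (uStat (hKer H) (fun i : Fin m => ω i) - mmdSq H P Q)
        ≤ x * sigmaM H P Q}) atTop (𝓝 (stdNormalCdf x)) := by
  rw [sigmaM_eq P Q hK] at hσ ⊢
  have hv : 0 < limitVar (P.prod Q) (hKer H) := Real.sqrt_pos.1 hσ
  have hna : NullSingletonClass (gaussianReal 0 (limitVar (P.prod Q) (hKer H)).toNNReal) :=
    nullSingletonClass_gaussianReal (Real.toNNReal_pos.2 hv).ne'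
  have h := tendsto_measureReal_uStat_le (ρ := P.prod Q) hK.measurable_hKer hK.abs_hKer_le
    (hKer_symm H) (c := x * √(limitVar (P.prod Q) (hKer H))) (measure_singleton _)
  rw [gaussianReal_Iic hv, mul_div_cancel_right₀ _ hσ.ne', hK.integral_hKer P Q] at h
  exact h

theorem IsBoundedKernel.tendsto_gKer_cdf (hK : IsBoundedKernel (S := S) H K) (hK0 : 0 < K)
    (hσ : 0 < sigmaStar H K P Q) (x : ℝ) :
    Tendsto (fun m : ℕ => (seqLaw P Q).real
      {ω | √(m : ℝ) * uStat (gKer H K (nammd H K P Q)) (fun i : Fin m => ω i) ≤ x}) atTop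
      (𝓝 (stdNormalCdf (x / sigmaStar H K P Q))) := by
  rw [sigmaStar_eq P Q hK] at hσ ⊢
  have hv := Real.sqrt_pos.1 hσ
  have hna : NullSingletonClass
      (gaussianReal 0 (limitVar (P.prod Q) (gKer H K (nammd H K P Q))).toNNReal) :=
    nullSingletonClass_gaussianReal (Real.toNNReal_pos.2 hv).ne'
  have h := tendsto_measureReal_uStat_le (ρ := P.prod Q) (hK.measurable_gKer _) (hK.abs_gKer_le _)
    (gKer_symm H K (nammd H K P Q)) (c := x) (measure_singleton _)
  rw [gaussianReal_Iic hv, hK.integral_gKer P Q hK0] at h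
  simpa only [sub_zero] using! h

/-- When `σ_*` vanishes, the limit law is a point mass at zero. -/
theorem IsBoundedKernel.tendsto_gKer_cdf_of_sigmaStar_eq_zero (hK : IsBoundedKernel (S := S) H K)
    (hK0 : 0 < K) (hσ : sigmaStar H K P Q = 0) {x : ℝ} (hx : x < 0) :
    Tendsto (fun m : ℕ => (seqLaw P Q).real
      {ω | √(m : ℝ) * uStat (gKer H K (nammd H K P Q)) (fun i : Fin m => ω i) ≤ x}) atTop
      (𝓝 0) := by
  rw [sigmaStar_eq P Q hK, Real.sqrt_eq_zero'] at hσ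
  have hv : (limitVar (P.prod Q) (gKer H K (nammd H K P Q))).toNNReal = 0 :=
    Real.toNNReal_of_nonpos hσ
  have h := tendsto_measureReal_uStat_le (ρ := P.prod Q) (hK.measurable_gKer _) (hK.abs_gKer_le _)
    (gKer_symm H K (nammd H K P Q)) (c := x) (by rw [hv]; simp [hx.ne'])
  rw [hv, hK.integral_gKer P Q hK0] at h
  simpa [hx, measureReal_def, seqLaw] using! h

/-- The two distribution functions of the central limit theorems, for `mmdSqHat` and for
`mmdSqHat - NAMMD * (denominator)`, and the tail of the denominator, combine to the required
bound uniformly over the window. Here `c` bounds the gain `T` of the NAMMD test from below. -/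
theorem IsBoundedKernel.exists_eventually_gap (hK : IsBoundedKernel (S := S) H K) (hK0 : 0 < K)
    (hσ : 0 < sigmaM H P Q) :
    ∃ c : ℝ → ℝ, (∀ a T : ℝ, 0 ≤ a → a ≤ 0.7 →
        a * sigmaM H P Q + (0.051 * sigmaM H P Q
          + 0.751 * max 0 (sigmaStar H K P Q - sigmaM H P Q)) ≤ T → c a ≤ T) ∧
      (∀ a : ℝ, 0 ≤ a → 0 < c a) ∧
      ∀ᶠ m : ℕ in atTop, ∀ a ∈ Set.Icc (0 : ℝ) 0.7, ∃ δ, 0 < δ ∧ δ < 1 ∧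
        1 / 65 ≤ (seqLaw P Q).real
            {ω | √(m : ℝ) * (uStat (hKer H) (fun i : Fin m => ω i) - mmdSq H P Q)
              ≤ -a * sigmaM H P Q}
          - (seqLaw P Q).real {ω | √(m : ℝ) *
              uStat (gKer H K (nammd H K P Q)) (fun i : Fin m => ω i) ≤ -((1 - δ) * c a)}
          - (samplesLaw P Q m).real {Z | normTerm H K P Q * δ
              ≤ normTerm H K P Q - uStat (nKer H K) (pairs Z)} := by
  have hN : 0 < normTerm H K P Q := by linarith [hK.two_mul_le_normTerm P Q]
  have hgap : ∀ a : ℝ, 0 ≤ a → a ≤ 0.7 →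
      1 / 65 < stdNormalCdf (-a) - stdNormalCdf (-(a + 0.051)) := fun a h0 h1 => by
    rw [stdNormalCdf_neg, stdNormalCdf_neg]
    linarith [one_div_lt_stdNormalCdf_sub h0 h1]
  have hF : ∀ m : ℕ, Monotone fun x : ℝ => (seqLaw P Q).real
      {ω | √(m : ℝ) * (uStat (hKer H) (fun i : Fin m => ω i) - mmdSq H P Q) ≤ x} :=
    fun m x y hxy => measureReal_mono fun ω hω => le_trans hω hxy
  have hG : ∀ m : ℕ, Monotone fun x : ℝ => (seqLaw P Q).real {ω | √(m : ℝ) *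
      uStat (gKer H K (nammd H K P Q)) (fun i : Fin m => ω i) ≤ x} :=
    fun m x y hxy => measureReal_mono fun ω hω => le_trans hω hxy
  have hD : ∀ δ : ℝ, 0 < δ → Tendsto (fun m : ℕ => (samplesLaw P Q m).real
      {Z | normTerm H K P Q * δ ≤ normTerm H K P Q - uStat (nKer H K) (pairs Z)}) atTop (𝓝 0) :=
    fun δ hδ => hK.tendsto_measureReal_denominator_le P Q hK0 (mul_pos hN hδ)
  have hs0 : 0 ≤ sigmaStar H K P Q := Real.sqrt_nonneg _
  rcases hs0.eq_or_lt with hs | hs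
  · refine ⟨fun _ => 0.051 * sigmaM H P Q, fun a T h0 _ hT => ?_, fun a _ => by positivity, ?_⟩
    · have h1 := mul_nonneg h0 hσ.le
      have h2 := le_max_left 0 (sigmaStar H K P Q - sigmaM H P Q)
      linarith
    · refine eventually_forall_one_div_le (φ := stdNormalCdf) (ψ := fun _ => 0) hσ.le hF hG
        continuous_stdNormalCdf continuous_const continuous_const monotone_const
        (fun _ _ => by positivity) (hK.tendsto_mmd_cdf P Q hσ)
        (fun x hx => hK.tendsto_gKer_cdf_of_sigmaStar_eq_zero P Q hK0 hs.symm hx) hD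
        fun a h0 h1 => (hgap a h0 h1).trans_le ?_
      exact sub_le_sub_left (cdf_nonneg _ _) _
  · refine ⟨fun a => (a + 0.051) * sigmaStar H K P Q, fun a T h0 h1 hT => ?_,
      fun a h0 => mul_pos (by linarith) hs, ?_⟩
    · refine le_trans ?_ hT
      rcases le_total (sigmaStar H K P Q) (sigmaM H P Q) with h | h
      · rw [max_eq_left (by linarith)]
        nlinarith
      · rw [max_eq_right (by linarith)]
        nlinarith
    · refine eventually_forall_one_div_le (φ := stdNormalCdf)
        (ψ := fun x => stdNormalCdf (x / sigmaStar H K P Q)) hσ.le hF hG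
        continuous_stdNormalCdf (continuous_stdNormalCdf.comp (by fun_prop)) (by fun_prop)
        (fun x y hxy => mul_le_mul_of_nonneg_right (by linarith) hs.le)
        (fun a ha => mul_pos (by linarith) hs) (hK.tendsto_mmd_cdf P Q hσ)
        (fun x _ => hK.tendsto_gKer_cdf P Q hK0 hs x) hD fun a h0 h1 => ?_
      have e : -((a + 0.051) * sigmaStar H K P Q) / sigmaStar H K P Q = -(a + 0.051) := by
        field_simp
      rw [e]
      exact hgap a h0 h1

/-- For large samples the MMD statistic falls below its threshold, by `a` standard deviations,
while the NAMMD statistic exceeds its threshold, with probability at least `1/65`. -/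
theorem IsBoundedKernel.exists_forall_one_div_le (hK : IsBoundedKernel (S := S) H K) (hK0 : 0 < K)
    (hσ : 0 < sigmaM H P Q) :
    ∃ m₀ : ℕ, ∀ m : ℕ, m₀ ≤ m → 2 ≤ m → ∀ a T : ℝ, 0 ≤ a → a ≤ 0.7 →
      a * sigmaM H P Q + (0.051 * sigmaM H P Q
        + 0.751 * max 0 (sigmaStar H K P Q - sigmaM H P Q)) ≤ T →
      1 / 65 ≤ (samplesLaw P Q m).real
        {Z | √(m : ℝ) * mmdSqHat H Z ≤ √(m : ℝ) * mmdSq H P Q - a * sigmaM H P Q ∧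
          √(m : ℝ) * nammd H K P Q - T / normTerm H K P Q < √(m : ℝ) * nammdHat H K Z} := by
  obtain ⟨c, hcT, hc0, hev⟩ := hK.exists_eventually_gap P Q hK0 hσ
  obtain ⟨m₀, hm₀⟩ := eventually_atTop.1 hev
  refine ⟨m₀, fun m hm hm2 a T ha0 ha1 hT => ?_⟩
  obtain ⟨δ, hδ0, hδ1, hδ⟩ := hm₀ m hm a ⟨ha0, ha1⟩
  have hN : 0 < normTerm H K P Q := by linarith [hK.two_mul_le_normTerm P Q]
  have hcT := hcT a T ha0 ha1 hT
  have hc0 := hc0 a ha0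
  set good : Set (Samples S m) :=
    {Z | √(m : ℝ) * mmdSqHat H Z ≤ √(m : ℝ) * mmdSq H P Q - a * sigmaM H P Q ∧
      √(m : ℝ) * nammd H K P Q - T / normTerm H K P Q < √(m : ℝ) * nammdHat H K Z}
  set low : Set (Samples S m) :=
    {Z | normTerm H K P Q * δ ≤ normTerm H K P Q - uStat (nKer H K) (pairs Z)}
  have hcover : {ω : ℕ → S × S | √(m : ℝ) *
        (uStat (hKer H) (fun i : Fin m => ω i) - mmdSq H P Q) ≤ -a * sigmaM H P Q}
      ⊆ (sampleMap S m ⁻¹' good ∪ {ω | √(m : ℝ) *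
          uStat (gKer H K (nammd H K P Q)) (fun i : Fin m => ω i) ≤ -((1 - δ) * c a)})
        ∪ sampleMap S m ⁻¹' low := by
    intro ω hω
    by_cases h1 : √(m : ℝ) * uStat (gKer H K (nammd H K P Q)) (fun i : Fin m => ω i)
      ≤ -((1 - δ) * c a)
    · exact Or.inl (Or.inr h1)
    by_cases h2 : sampleMap S m ω ∈ low
    · exact Or.inr h2
    refine Or.inl (Or.inl ?_)
    have hω' : √(m : ℝ) * (uStat (hKer H) (fun i : Fin m => ω i) - mmdSq H P Q)
      ≤ -a * sigmaM H P Q := hω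
    have h2' : ¬ normTerm H K P Q * δ
      ≤ normTerm H K P Q - uStat (nKer H K) (fun i : Fin m => ω i) := h2
    have hUN : 0 < uStat (nKer H K) (fun i : Fin m => ω i) := by
      linarith [(uStat_mem_Icc hm2 hK.nKer_mem_Icc (fun i : Fin m => ω i)).1]
    have eg : uStat (gKer H K (nammd H K P Q)) (fun i : Fin m => ω i)
        = uStat (hKer H) (fun i : Fin m => ω i)
          - nammd H K P Q * uStat (nKer H K) (fun i : Fin m => ω i) :=
      uStat_sub_const_mul _ _ _ _
    rw [eg] at h1
    constructor
    · change √(m : ℝ) * uStat (hKer H) (fun i : Fin m => ω i) ≤ _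
      linarith
    · rw [nammdHat_eq_uStat H K hm2]
      change _ < √(m : ℝ) * (uStat (hKer H) (fun i : Fin m => ω i)
        / uStat (nKer H K) (fun i : Fin m => ω i))
      generalize uStat (hKer H) (fun i : Fin m => ω i) = U at *
      generalize uStat (nKer H K) (fun i : Fin m => ω i) = V at *
      push Not at h1 h2'
      rw [← mul_div_assoc, lt_div_iff₀ hUN]
      have h3 : (1 - δ) * c a ≤ T / normTerm H K P Q * V := by
        rw [div_mul_eq_mul_div, le_div_iff₀ hN]
        have hV : normTerm H K P Q * (1 - δ) ≤ V := by linarith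
        calc (1 - δ) * c a * normTerm H K P Q = c a * (normTerm H K P Q * (1 - δ)) := by ring
          _ ≤ c a * V := mul_le_mul_of_nonneg_left hV hc0.le
          _ ≤ T * V := mul_le_mul_of_nonneg_right hcT hUN.le
      linarith
  have h1 := (measureReal_mono hcover (μ := seqLaw P Q)).trans
    ((measureReal_union_le _ _).trans (add_le_add_left (measureReal_union_le _ _) _))
  have h2 : (seqLaw P Q).real (sampleMap S m ⁻¹' good) ≤ _ :=
    measureReal_sampleMap_preimage_le P Q good
  have h3 : (seqLaw P Q).real (sampleMap S m ⁻¹' low) ≤ _ :=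
    measureReal_sampleMap_preimage_le P Q low
  linarith

end disagree

end NAMMD

end

theorem mainTheorem1 {S : Type*} [MeasurableSpace S]
    {H : Type*} [NormedAddCommGroup H] [InnerProductSpace ℝ H] [CompleteSpace H] [RKHS ℝ H S ℝ]
    (K : ℝ) (hK : NAMMD.IsBoundedKernel H K)
    (P₂ Q₂ : Measure S) [IsProbabilityMeasure P₂] [IsProbabilityMeasure Q₂] :
    ∃ m₀ : ℕ, ∀ (P₁ Q₁ : Measure S) [IsProbabilityMeasure P₁] [IsProbabilityMeasure Q₁] (α : ℝ),
      0 < α → α < 1 →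
      0 < NAMMD.nammd H K P₁ Q₁ →
      NAMMD.nammd H K P₁ Q₁ < NAMMD.nammd H K P₂ Q₂ →
      NAMMD.mmdSq H P₁ Q₁ < NAMMD.mmdSq H P₂ Q₂ →
      ‖NAMMD.meanEmbedding H P₁‖ ^ 2 + ‖NAMMD.meanEmbedding H Q₁‖ ^ 2
        < ‖NAMMD.meanEmbedding H P₂‖ ^ 2 + ‖NAMMD.meanEmbedding H Q₂‖ ^ 2 →
      ∀ m : ℕ, 2 ≤ m →
        (α ≤ 1 / 2 →
          NAMMD.gapDelta H K P₁ Q₁ P₂ Q₂ α m ∈ Set.Ioo (0 : ℝ) (1 / 2)) ∧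
        (NAMMD.gapDelta H K P₁ Q₁ P₂ Q₂ α m ∈ Set.Ioo (0 : ℝ) (1 / 2) →
          1 - Real.exp (-((m : ℝ) * NAMMD.gapDelta H K P₁ Q₁ P₂ Q₂ α m ^ 2
                * NAMMD.normTerm H K P₂ Q₂ ^ 2
                / (4 * K ^ 2 * (1 - NAMMD.gapDelta H K P₁ Q₁ P₂ Q₂ α m) ^ 2)))
            ≤ (NAMMD.samplesLaw P₂ Q₂ m).real
                {Z | NAMMD.MMDRejects H P₁ Q₁ P₂ Q₂ α Z →
                  NAMMD.NAMMDRejects H K P₁ Q₁ P₂ Q₂ α Z}) ∧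
        (NAMMD.windowLower H K P₁ Q₁ P₂ Q₂ α (NAMMD.sigmaM H P₂ Q₂) ≤ m →
          (m : ℝ) ≤ NAMMD.windowUpper H P₁ Q₁ P₂ Q₂ α →
          1 / 65 ≤ NAMMD.normalPowerN H K P₁ Q₁ P₂ Q₂ α m
            - NAMMD.normalPowerM H P₁ Q₁ P₂ Q₂ α m) ∧
        (m₀ ≤ m →
          NAMMD.windowLower H K P₁ Q₁ P₂ Q₂ α (NAMMD.sigmaStar H K P₂ Q₂) ≤ m →
          (m : ℝ) ≤ NAMMD.windowUpper H P₁ Q₁ P₂ Q₂ α →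
          1 / 65 ≤ (NAMMD.samplesLaw P₂ Q₂ m).real
            {Z | ¬ NAMMD.MMDRejects H P₁ Q₁ P₂ Q₂ α Z ∧
              NAMMD.NAMMDRejects H K P₁ Q₁ P₂ Q₂ α Z}) := by
  -- if `σ_M = 0`, the window is empty and any `m₀` will do
  obtain ⟨m₀, hm₀⟩ : ∃ m₀ : ℕ, 0 < K → 0 < NAMMD.sigmaM H P₂ Q₂ → ∀ m : ℕ, m₀ ≤ m → 2 ≤ m →
      ∀ a T : ℝ, 0 ≤ a → a ≤ 0.7 →
        a * NAMMD.sigmaM H P₂ Q₂ + (0.051 * NAMMD.sigmaM H P₂ Q₂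
          + 0.751 * max 0 (NAMMD.sigmaStar H K P₂ Q₂ - NAMMD.sigmaM H P₂ Q₂)) ≤ T →
        1 / 65 ≤ (NAMMD.samplesLaw P₂ Q₂ m).real
          {Z | √(m : ℝ) * NAMMD.mmdSqHat H Z
              ≤ √(m : ℝ) * NAMMD.mmdSq H P₂ Q₂ - a * NAMMD.sigmaM H P₂ Q₂ ∧
            √(m : ℝ) * NAMMD.nammd H K P₂ Q₂ - T / NAMMD.normTerm H K P₂ Q₂
              < √(m : ℝ) * NAMMD.nammdHat H K Z} := by
    by_cases h : 0 < K ∧ 0 < NAMMD.sigmaM H P₂ Q₂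
    · obtain ⟨m₀, hm₀⟩ := hK.exists_forall_one_div_le P₂ Q₂ h.1 h.2
      exact ⟨m₀, fun _ _ => hm₀⟩
    · exact ⟨0, fun h1 h2 => absurd ⟨h1, h2⟩ h⟩
  refine ⟨m₀, fun P₁ Q₁ _ _ α _ _ hε _ hM hnorm m hm => ?_⟩
  have hm' : (2 : ℝ) ≤ m := by exact_mod_cast hm
  have h1K := hK.two_mul_le_normTerm P₁ Q₁
  have h2K := hK.two_mul_le_normTerm P₂ Q₂
  have hN : NAMMD.normTerm H K P₂ Q₂ < NAMMD.normTerm H K P₁ Q₁ := by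
    rw [NAMMD.normTerm, NAMMD.normTerm]; linarith
  have hM1' : 0 ≤ NAMMD.mmdSq H P₁ Q₁ := sq_nonneg _
  have hM1 : 0 < NAMMD.mmdSq H P₁ Q₁ := by
    refine hM1'.lt_of_ne' fun h => ?_
    rw [NAMMD.nammd, h, zero_div] at hε
    exact lt_irrefl _ hε
  have hN1 : 0 < NAMMD.normTerm H K P₁ Q₁ := by
    rw [NAMMD.nammd, div_pos_iff_of_pos_left hM1] at hε; exact hε
  -- `K = 0` would make every mean embedding vanish
  have hK0 : 0 < K := by
    have : 0 ≤ K := (sq_nonneg _).trans (hK.norm_meanEmbedding_sq_le P₁)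
    refine this.lt_of_ne' fun h => ?_
    subst h
    rw [NAMMD.normTerm] at hN1
    linarith [sq_nonneg ‖NAMMD.meanEmbedding H P₁‖, sq_nonneg ‖NAMMD.meanEmbedding H Q₁‖]
  have hN2 : 0 < NAMMD.normTerm H K P₂ Q₂ := by linarith
  have hr : NAMMD.normTerm H K P₂ Q₂ / NAMMD.normTerm H K P₁ Q₁ < 1 := (div_lt_one hN1).2 hN
  have hσ : 0 ≤ NAMMD.sigmaM H P₂ Q₂ := Real.sqrt_nonneg _
  refine ⟨fun hα => NAMMD.gapDelta_mem_Ioo hα hm hε h2K hN2 hN,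
    fun hΔ => hK.measureReal_imp_ge hK0 hm hε hN hΔ, fun hlow hup => ?_, fun hmm hlow hup => ?_⟩
  · obtain ⟨hσ0, ha0, ha1, hl⟩ := NAMMD.window_bounds (by linarith) hσ hM hr hM1
      (by have := le_max_left 0 (NAMMD.sigmaM H P₂ Q₂ - NAMMD.sigmaM H P₂ Q₂); positivity) hlow hup
    refine NAMMD.one_div_le_normalPowerN_sub hN1 hN2 hσ0 rfl ha0 ha1 ?_
    rwa [sub_self, max_self, mul_zero, add_zero] at hl
  · obtain ⟨hσ0, ha0, ha1, hl⟩ := NAMMD.window_bounds (by linarith) hσ hM hr hM1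
      (by have := le_max_left 0 (NAMMD.sigmaStar H K P₂ Q₂ - NAMMD.sigmaM H P₂ Q₂); positivity)
      hlow hup
    refine (hm₀ hK0 hσ0 m hmm hm _ _ ha0 ha1 (add_le_add_right hl _)).trans_eq ?_
    congr 1
    ext Z
    have e1 : √(m : ℝ) * NAMMD.mmdSq H P₂ Q₂
        - (√(m : ℝ) * (NAMMD.mmdSq H P₂ Q₂ - NAMMD.mmdSq H P₁ Q₁) / NAMMD.sigmaM H P₂ Q₂
          - NAMMD.normalQuantile α) * NAMMD.sigmaM H P₂ Q₂ = NAMMD.tauM H P₁ Q₁ P₂ Q₂ α m := by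
      rw [NAMMD.tauM]; field_simp; ring
    have e2 : √(m : ℝ) * NAMMD.nammd H K P₂ Q₂
        - ((√(m : ℝ) * (NAMMD.mmdSq H P₂ Q₂ - NAMMD.mmdSq H P₁ Q₁) / NAMMD.sigmaM H P₂ Q₂
          - NAMMD.normalQuantile α) * NAMMD.sigmaM H P₂ Q₂ + √(m : ℝ)
            * ((1 - NAMMD.normTerm H K P₂ Q₂ / NAMMD.normTerm H K P₁ Q₁)
              * NAMMD.mmdSq H P₁ Q₁)) / NAMMD.normTerm H K P₂ Q₂
          = NAMMD.tauN H K P₁ Q₁ P₂ Q₂ α m := by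
      rw [NAMMD.tauN, NAMMD.nammd, NAMMD.nammd]; field_simp; ring
    rw [e1, e2]
    simp only [NAMMD.MMDRejects, NAMMD.NAMMDRejects, not_lt]
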